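/- Consider $K$ players with actions $x^{(k)}\in\mathbb{R}^d$, joint action $x=(x^{(1)},\dots,x^{(K)})\in\mathbb{R}^{Kd}$ and utilities $u_k:\mathbb{R}^{Kd}\to\mathbb{R}$, each differentiable in the player's own action. Let $F(x)=(\nabla_{x^{(1)}}u_1(x),\dots,\nabla_{x^{(K)}}u_K(x))$. Assume that the game is strongly monotone, i.e. for some $\lambda_0>0$ $$\langle x_2-x_1,F(x_2)-F(x_1)\rangle\le-\lambda_0\|x_2-x_1\|_2^2\qquad\text{for all }x_1,x_2\in\mathbb{R}^{Kd},$$ and that $F$ is $\ell$-Lipschitz in the Euclidean norm. Let $A\in\mathbb{R}^{c\times Kd}$ have full row rank and let $b\in\mathbb{R}^c$. Then there is a unique pair $(x^*,y^*)\in\mathbb{R}^{Kd}\times\mathbb{R}^c$ with $Ax^*=b$ and $F(x^*)=A^{T}y^*$. Let $\alpha',\beta'>0$, $\alpha_0,\beta_0>0$, $\alpha_n=\alpha_0/(n+1)^{2/3}$, $\beta_n=\beta_0/(n+1)$, and consider the distributed two-time-scale primal-dual iteration in which each player $k$ uses a noisy gradient of its own utility and the commonly observed noisy constraint violation: $$x^{(k)}_{n+1}=x^{(k)}_n+\alpha'\alpha_n\big(\nabla_{x^{(k)}}u_k(x_n)+M^{(k)}_{n+1}-(A^{T}y_n)^{(k)}\big),\qquad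 y_{n+1}=y_n+\beta'\beta_n\big(Ax_n-b+M'_{n+1}\big),$$ where $z^{(k)}\in\mathbb{R}^d$ denotes the $k$-th block of $z\in\mathbb{R}^{Kd}$. Put $M''_n=\alpha'M_n$ and $M'''_n=\beta'M'_n$, and assume that $(M''_{n+1})$ and $(M'''_{n+1})$ are martingale difference sequences with respect to $\mathcal{F}_n=\sigma(x_0,y_0,M''_k,M'''_k,\,1\le k\le n)$ and that, for some constant $\kappa>0$, almost surely $$\|M''_{n+1}\|_2+\|M'''_{n+1}\|_2\le\kappa(1+\|x_n\|_2+\|y_n\|_2)\qquad\text{for all }n\ge0.$$ Then $(x_n,y_n)\to(x^*,y^*)$ almost surely. Furthermore, there is a constant $C_3'>0$, depending only on $K$, $d$, $A$, $\lambda_0$, $\ell$ and $\beta'$, such that if $\beta_0\ge C_3'$ and $\mathbb{E}[\|x_0\|_2^2+\|y_0\|_2^2]<\infty$, then $$\mathbb{E}\left[\|Ax_n-b\|_2^2+\|x_n-x^*\|_2^2\right]=\mathcal{O}\left(\frac{1}{(n+1)^{2/3}}\right)\qquad(n\to\infty),$$ and in particular these expectations are finite for every $n$. -/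

import Mathlib

open MeasureTheory ProbabilityTheory Filter Asymptotics
open scoped Topology NNReal Matrix

noncomputable section

namespace GNELearning

/-- The joint action space `ℝ^{Kd}` of `K` players with actions in `ℝ^d`, with the Euclidean
norm. The coordinate `(k, j)` of `x` is the `j`-th coordinate of the action of player `k`. -/
abbrev Joint (K d : ℕ) : Type := EuclideanSpace ℝ (Fin K × Fin d)

/-- The action `x^{(k)}` of player `k` in the action profile `x`. -/
def action {K d : ℕ} (x : Joint K d) (k : Fin K) : EuclideanSpace ℝ (Fin d) :=
  WithLp.toLp 2 fun j => x (k, j)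

/-- The action profile in which player `k` plays `z` and all other players play as in `x`. -/
def deviate {K d : ℕ} (x : Joint K d) (k : Fin K) (z : EuclideanSpace ℝ (Fin d)) : Joint K d :=
  WithLp.toLp 2 fun p => if p.1 = k then z p.2 else x p

/-- The partial gradient `∇_{x^{(k)}} u_k (x)` of the utility of player `k` with respect to the
action of player `k`. -/
def ownGradient {K d : ℕ} (u : Fin K → Joint K d → ℝ) (k : Fin K) (x : Joint K d) :
    EuclideanSpace ℝ (Fin d) :=
  gradient (fun z => u k (deviate x k z)) (action x k)

/-- The gradient operator `F(x) = (∇_{x^{(1)}} u_1 (x), …, ∇_{x^{(K)}} u_K (x))`. -/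
def gradientOperator {K d : ℕ} (u : Fin K → Joint K d → ℝ) (x : Joint K d) : Joint K d :=
  WithLp.toLp 2 fun p => ownGradient u p.1 x p.2

/-- The game with utilities `u` is strongly monotone with modulus `lam`, and its gradient operator
is `ell`-Lipschitz. Every utility is differentiable in the action of its own player, so that the
gradient operator is meaningful. -/
structure IsStronglyMonotoneGame {K d : ℕ} (u : Fin K → Joint K d → ℝ) (lam : ℝ) (ell : ℝ≥0) :
    Prop where
  differentiable : ∀ (k : Fin K) (x : Joint K d),
    DifferentiableAt ℝ (fun z => u k (deviate x k z)) (action x k)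
  strongly_monotone : ∀ x₁ x₂ : Joint K d,
    inner ℝ (x₂ - x₁) (gradientOperator u x₂ - gradientOperator u x₁) ≤ -lam * ‖x₂ - x₁‖ ^ 2
  lipschitz : LipschitzWith ell (gradientOperator u)

/-- The matrix-vector product `A v` between Euclidean spaces. -/
def matVec {m n : Type*} [Fintype n] (A : Matrix m n ℝ) (v : EuclideanSpace ℝ n) :
    EuclideanSpace ℝ m :=
  WithLp.toLp 2 (A *ᵥ WithLp.ofLp v)

/-- The `σ`-field `ℱ_n = σ(x_0, y_0, N_k, N'_k, 1 ≤ k ≤ n)`. -/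
@[reducible] def history {Ω E G : Type*} [MeasurableSpace E] [MeasurableSpace G]
    (x₀ : Ω → E) (y₀ : Ω → G) (N : ℕ → Ω → E) (N' : ℕ → Ω → G) (n : ℕ) : MeasurableSpace Ω :=
  MeasurableSpace.comap x₀ inferInstance ⊔ MeasurableSpace.comap y₀ inferInstance ⊔
    ⨆ k ∈ Set.Icc 1 n,
      (MeasurableSpace.comap (N k) inferInstance ⊔ MeasurableSpace.comap (N' k) inferInstance)

/-- `(N_{n+1})` and `(N'_{n+1})` are martingale difference sequences with respect to the
`σ`-fields `ℱ_n = σ(x_0, y_0, N_k, N'_k, 1 ≤ k ≤ n)`, and they grow at most linearly in the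
iterates, with constant `κ`. The values `N 0` and `N' 0` play no role. -/
structure IsMartingaleNoise {Ω E G : Type*} [MeasurableSpace Ω] (P : Measure Ω)
    [NormedAddCommGroup E] [NormedSpace ℝ E] [CompleteSpace E] [MeasurableSpace E]
    [NormedAddCommGroup G] [NormedSpace ℝ G] [CompleteSpace G] [MeasurableSpace G]
    (κ : ℝ) (x : ℕ → Ω → E) (y : ℕ → Ω → G) (N : ℕ → Ω → E) (N' : ℕ → Ω → G) : Prop where
  measurable_init : Measurable (x 0) ∧ Measurable (y 0)
  measurable_noise : ∀ n, Measurable (N (n + 1)) ∧ Measurable (N' (n + 1))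
  integrable_noise : ∀ n, Integrable (N (n + 1)) P ∧ Integrable (N' (n + 1)) P
  condExp_eq_zero : ∀ n, P[N (n + 1) | history (x 0) (y 0) N N' n] =ᵐ[P] 0
  condExp_eq_zero' : ∀ n, P[N' (n + 1) | history (x 0) (y 0) N N' n] =ᵐ[P] 0
  linear_growth : ∀ n, ∀ᵐ ω ∂P,
    ‖N (n + 1) ω‖ + ‖N' (n + 1) ω‖ ≤ κ * (1 + ‖x n ω‖ + ‖y n ω‖)

/-- The two-time-scale primal-dual iteration. At time `n`, player `k` observes the noisy gradient
`∇_{x^{(k)}} u_k (x_n) + M_{n+1}^{(k)}` and the noisy constraint violation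
`A x_n - b + M'_{n+1}`; `a n` and `s n` are the step sizes of the fast and the slow update:
`x_{n+1}^{(k)} = x_n^{(k)} + a_n (∇_{x^{(k)}} u_k (x_n) + M_{n+1}^{(k)} - (Aᵀ y_n)^{(k)})` and
`y_{n+1} = y_n + s_n (A x_n - b + M'_{n+1})`. -/
structure IsPrimalDualIteration {Ω : Type*} {K d c : ℕ} (u : Fin K → Joint K d → ℝ)
    (A : Matrix (Fin c) (Fin K × Fin d) ℝ) (b : EuclideanSpace ℝ (Fin c)) (a s : ℕ → ℝ)
    (M : ℕ → Ω → Joint K d) (M' : ℕ → Ω → EuclideanSpace ℝ (Fin c))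
    (x : ℕ → Ω → Joint K d) (y : ℕ → Ω → EuclideanSpace ℝ (Fin c)) : Prop where
  primal : ∀ n ω k, action (x (n + 1) ω) k = action (x n ω) k +
    a n • (ownGradient u k (x n ω) + action (M (n + 1) ω) k - action (matVec Aᵀ (y n ω)) k)
  dual : ∀ n ω, y (n + 1) ω = y n ω + s n • (matVec A (x n ω) - b + M' (n + 1) ω)

end GNELearning

end

noncomputable section

/-! Strong monotonicity and the Lipschitz bound make `F x = Aᵀ y` uniquely solvable by a primal
response x = h(y), Lipschitz in y. The reduced dual map g(y) = A h(y) - b is again strongly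
antimonotone: ⟨y' - y, g y' - g y⟩ = ⟨h y' - h y, F(h y') - F(h y)⟩, and ‖h y' - h y‖ dominates ‖y'
- y‖ because F is Lipschitz and full row rank bounds `Aᵀ` from below. So g has a unique zero y*, and
x* = h(y*) (`exists_isSaddleSystem`, `solution_iff`).

The iteration is controlled by two gaps, Z = ‖x_n - h(y_n)‖² and Y = ‖y_n - y*‖². Write r =
(n+1)^(-2/3) and σ = 1/(n+1). Up to martingale differences, Z contracts by a factor 1 - const·r and
Y by 1 - const·σ; the dual recursion also receives const·σ·Z, and the remaining errors are O(r²)(1 +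
Z + Y) (`primal_step`, `dual_step`). The target h(y_n) moves by O(σ) in one step; separating this
motion by Young's inequality costs σ²/r, which equals r² because σ² = r³.

Since σ/r → 0, the contraction of Z eventually absorbs the term σ·Z, so 1 + Z + Y is an almost
supermartingale with summable coefficients O(r²). Robbins–Siegmund gives convergence and ∑ σ(Z + Y)
< ∞, and divergence of ∑ σ forces the limit of Z + Y to be 0. Initial values without second moments
are treated by freezing the iteration off events where they are bounded (`localize`).

For the rate, the same recursions hold for expectations. They give in turn a uniform bound on 1 + 𝔼Z
+ 𝔼Y, then 𝔼Z = O(r), then 𝔼Y = O(r). The last step needs β₀ large, so that the dual contraction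
outpaces the decay of r. -/

namespace GNELearning

/-! ### Step-size scales -/

/-- The fast scale `(n + 1) ^ (-2/3)`. -/
def fastScale (n : ℕ) : ℝ := 1 / ((n : ℝ) + 1) ^ (2 / 3 : ℝ)

/-- The slow scale `(n + 1)⁻¹`. -/
def slowScale (n : ℕ) : ℝ := 1 / ((n : ℝ) + 1)

lemma fastScale_pos (n : ℕ) : 0 < fastScale n := by unfold fastScale; positivity

lemma slowScale_pos (n : ℕ) : 0 < slowScale n := by unfold slowScale; positivity

lemma fastScale_le_one (n : ℕ) : fastScale n ≤ 1 := by
  unfold fastScale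
  rw [div_le_one (by positivity)]
  exact Real.one_le_rpow (by linarith [(Nat.cast_nonneg n : (0 : ℝ) ≤ n)]) (by norm_num)

lemma fastScale_cube (n : ℕ) : fastScale n ^ 3 = slowScale n ^ 2 := by
  have hn : (0 : ℝ) ≤ (n : ℝ) + 1 := by positivity
  unfold fastScale slowScale
  rw [div_pow, div_pow, ← Real.rpow_natCast (((n : ℝ) + 1) ^ (2 / 3 : ℝ)) 3, ← Real.rpow_mul hn]
  norm_num

/-- The ratio of the two scales is `√(fastScale n)`, which tends to 0: this is the time-scale
separation. -/
lemma slowScale_eq (n : ℕ) : slowScale n = fastScale n * √(fastScale n) := by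
  have hr := fastScale_pos n
  have h : slowScale n ^ 2 = (fastScale n * √(fastScale n)) ^ 2 := by
    rw [mul_pow, Real.sq_sqrt hr.le, ← fastScale_cube]; ring
  exact (pow_left_inj₀ (slowScale_pos n).le (by positivity) two_ne_zero).1 h

lemma slowScale_le_fastScale (n : ℕ) : slowScale n ≤ fastScale n := by
  rw [slowScale_eq]
  exact mul_le_of_le_one_right (fastScale_pos n).le (Real.sqrt_le_one.2 (fastScale_le_one n))

lemma tendsto_fastScale : Tendsto fastScale atTop (𝓝 0) := by
  have h1 : Tendsto (fun n : ℕ => (n : ℝ) + 1) atTop atTop :=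
    tendsto_atTop_add_const_right _ _ tendsto_natCast_atTop_atTop
  have h2 := ((tendsto_rpow_atTop (by norm_num : (0 : ℝ) < 2 / 3)).comp h1).inv_tendsto_atTop
  refine h2.congr fun n => ?_
  simp [fastScale]

lemma eventually_slowScale_le {ε : ℝ} (hε : 0 < ε) :
    ∀ᶠ n in atTop, slowScale n ≤ ε * fastScale n := by
  have h : Tendsto (fun n => √(fastScale n)) atTop (𝓝 0) := by
    simpa using tendsto_fastScale.sqrt
  filter_upwards [h.eventually_le_const hε] with n hn
  rw [slowScale_eq, mul_comm]
  exact mul_le_mul_of_nonneg_right hn (fastScale_pos n).le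

/-- For t = (n+1)/(n+2) ≤ 1 one has t^(2/3) ≥ t ≥ 1 - 1/(n+1). The fast scale thus decays at
relative speed at most σ, which any stronger contraction can track. -/
lemma fastScale_sub_succ_le (n : ℕ) :
    fastScale n - fastScale (n + 1) ≤ slowScale n * fastScale n := by
  have hn : (0 : ℝ) < (n : ℝ) + 1 := by positivity
  have hn2 : (0 : ℝ) < (n : ℝ) + 1 + 1 := by positivity
  have h1 : ((n : ℝ) + 1) / ((n : ℝ) + 1 + 1) ≤
      (((n : ℝ) + 1) / ((n : ℝ) + 1 + 1)) ^ (2 / 3 : ℝ) := by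
    conv_lhs => rw [← Real.rpow_one (((n : ℝ) + 1) / ((n : ℝ) + 1 + 1))]
    exact Real.rpow_le_rpow_of_exponent_ge (by positivity)
      (by rw [div_le_one hn2]; linarith) (by norm_num)
  rw [Real.div_rpow hn.le hn2.le] at h1
  have h2 : fastScale (n + 1) =
      fastScale n * (((n : ℝ) + 1) ^ (2 / 3 : ℝ) / ((n : ℝ) + 1 + 1) ^ (2 / 3 : ℝ)) := by
    unfold fastScale; push_cast; field_simp
  have h3 : 1 - slowScale n ≤ ((n : ℝ) + 1) / ((n : ℝ) + 1 + 1) := by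
    unfold slowScale
    rw [le_div_iff₀ hn2]
    have : 1 / ((n : ℝ) + 1) * ((n : ℝ) + 1) = 1 := by field_simp
    nlinarith [one_div_pos.2 hn]
  rw [h2]
  nlinarith [fastScale_pos n]

lemma summable_fastScale_sq : Summable fun n => fastScale n ^ 2 := by
  have h : Summable fun n : ℕ => 1 / (n : ℝ) ^ (4 / 3 : ℝ) :=
    Real.summable_one_div_nat_rpow.2 (by norm_num)
  refine ((summable_nat_add_iff 1).2 h).congr fun n => ?_
  unfold fastScale
  rw [div_pow, ← Real.rpow_natCast (((n : ℝ) + 1) ^ (2 / 3 : ℝ)) 2,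
    ← Real.rpow_mul (by positivity)]
  norm_num

lemma not_summable_slowScale : ¬ Summable slowScale := by
  intro h
  refine Real.not_summable_one_div_natCast ((summable_nat_add_iff 1).1 (h.congr fun n => ?_))
  simp [slowScale]

/-! ### Real recursions -/

/-- If `v (n + 1) ≤ (1 + η n) v n` eventually with `∑ η < ∞`, then `v` is bounded above. -/
lemma exists_bound_of_recursion {v η : ℕ → ℝ} (hη0 : ∀ n, 0 ≤ η n) (hη : Summable η)
    (hv0 : ∀ n, 0 ≤ v n) {n₀ : ℕ} (hv : ∀ n ≥ n₀, v (n + 1) ≤ (1 + η n) * v n) :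
    ∃ B, ∀ n ≥ n₀, v n ≤ B := by
  have key : ∀ n ≥ n₀, v n ≤ v n₀ * Real.exp (∑ k ∈ Finset.range n, η k) := by
    intro n hn
    induction n, hn using Nat.le_induction with
    | base =>
      exact le_mul_of_one_le_right (hv0 _) (Real.one_le_exp (Finset.sum_nonneg fun k _ => hη0 k))
    | succ n hn ih =>
      rw [Finset.sum_range_succ, Real.exp_add]
      calc v (n + 1) ≤ (1 + η n) * v n := hv n hn
        _ ≤ Real.exp (η n) * (v n₀ * Real.exp (∑ k ∈ Finset.range n, η k)) := by
            refine mul_le_mul ?_ ih (hv0 n) (Real.exp_pos _).le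
            linarith [Real.add_one_le_exp (η n)]
        _ = _ := by ring
  refine ⟨v n₀ * Real.exp (∑' k, η k), fun n hn => (key n hn).trans ?_⟩
  gcongr
  · exact hv0 n₀
  · exact hη.sum_le_tsum _ fun k _ => hη0 k

/-- A contracting recursion with a forcing term comparable to `g n * ρ n` is of order `ρ n`. -/
lemma exists_rate_of_recursion {z g ρ : ℕ → ℝ} {C : ℝ} (hC : 0 ≤ C) (hρ : ∀ n, 0 < ρ n)
    {n₀ : ℕ} (hg0 : ∀ n ≥ n₀, 0 ≤ g n) (hg1 : ∀ n ≥ n₀, g n ≤ 1)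
    (hρg : ∀ n ≥ n₀, ρ n - ρ (n + 1) ≤ g n * ρ n / 2)
    (hz : ∀ n ≥ n₀, z (n + 1) ≤ (1 - g n) * z n + C * (g n * ρ n)) :
    ∃ D, 0 ≤ D ∧ ∀ n ≥ n₀, z n ≤ D * ρ n := by
  -- Half of the contraction pays for the decrease of `ρ`, the other half for the forcing term; the
  -- latter requires `2 * C ≤ D`.
  obtain ⟨D, hD0, hDC, hD⟩ : ∃ D, 0 ≤ D ∧ 2 * C ≤ D ∧ z n₀ ≤ D * ρ n₀ :=
    ⟨max (2 * C) (z n₀ / ρ n₀), le_max_of_le_left (by positivity), le_max_left _ _,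
      (div_le_iff₀ (hρ n₀)).1 (le_max_right _ _)⟩
  refine ⟨D, hD0, fun n hn => ?_⟩
  induction n, hn using Nat.le_induction with
  | base => exact hD
  | succ n hn ih =>
    have h1 := mul_le_mul_of_nonneg_left ih (sub_nonneg.2 (hg1 n hn))
    have h2 := mul_le_mul_of_nonneg_left (hρg n hn) hD0
    have h3 := mul_le_mul_of_nonneg_right hDC (mul_nonneg (hg0 n hn) (hρ n).le)
    linarith [hz n hn]

/-- A positive limit would give d ≤ (2/l)·d·w eventually, making `d` summable. -/
lemma tendsto_zero_of_summable_mul {d w : ℕ → ℝ} {l : ℝ} (hd : ∀ n, 0 ≤ d n)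
    (hds : ¬ Summable d) (hw0 : ∀ n, 0 ≤ w n) (hw : Tendsto w atTop (𝓝 l))
    (hs : Summable fun n => d n * w n) : l = 0 := by
  by_contra hl
  have hl0 : 0 < l := lt_of_le_of_ne (ge_of_tendsto' hw hw0) (Ne.symm hl)
  obtain ⟨N, hN⟩ := eventually_atTop.1 (hw.eventually_const_le (half_lt_self hl0))
  refine hds ((summable_nat_add_iff N).1 ?_)
  refine Summable.of_nonneg_of_le (fun n => hd _) (fun n => ?_)
    (((summable_nat_add_iff N).2 hs).mul_left (2 / l))
  have h := mul_le_mul_of_nonneg_left (hN (n + N) (by omega)) (hd (n + N))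
  rw [div_mul_eq_mul_div, le_div_iff₀ hl0]
  linarith

/-! ### Almost supermartingales -/

/-- The Robbins–Siegmund theorem for almost supermartingales whose increments are dominated
pathwise by a drift and a martingale difference. -/
theorem ae_tendsto_and_summable_of_almost_supermartingale {Ω : Type*} {m0 : MeasurableSpace Ω}
    {P : Measure Ω} [IsFiniteMeasure P] {ℱ : Filtration ℕ m0} {V D m : ℕ → Ω → ℝ} {η : ℕ → ℝ}
    (hη0 : ∀ n, 0 ≤ η n) (hη : Summable η)
    (hVm : StronglyAdapted ℱ V) (hDm : StronglyAdapted ℱ D)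
    (hVi : ∀ n, Integrable (V n) P) (hDi : ∀ n, Integrable (D n) P)
    (hmi : ∀ n, Integrable (m n) P) (hV0 : ∀ n ω, 0 ≤ V n ω) (hD0 : ∀ n ω, 0 ≤ D n ω)
    (hm : ∀ n, P[m n | ℱ n] =ᵐ[P] 0)
    (hV : ∀ n, ∀ᵐ ω ∂P, V (n + 1) ω ≤ (1 + η n) * V n ω - D n ω + m n ω) :
    ∀ᵐ ω ∂P, (∃ l, Tendsto (fun n => V n ω) atTop (𝓝 l)) ∧ Summable fun n => D n ω := by
  -- Discount weights: since 1 + η ≤ exp η, they cancel the growth factors, and summability of `η`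
  -- keeps them away from 0.
  set q : ℕ → ℝ := fun n => Real.exp (-∑ k ∈ Finset.range n, η k) with hq
  have hq0 : ∀ n, 0 < q n := fun n => Real.exp_pos _
  have hqs : ∀ n, q (n + 1) * (1 + η n) ≤ q n := by
    intro n
    have h1 : q (n + 1) * Real.exp (η n) = q n := by
      simp only [hq]
      rw [← Real.exp_add, Finset.sum_range_succ]; congr 1; ring
    rw [← h1]
    exact mul_le_mul_of_nonneg_left (by linarith [Real.add_one_le_exp (η n)]) (hq0 _).le
  have hqlim : Tendsto q atTop (𝓝 (Real.exp (-∑' k, η k))) :=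
    (Real.continuous_exp.tendsto _).comp hη.hasSum.tendsto_sum_nat.neg
  have hqlow : ∀ n, Real.exp (-∑' k, η k) ≤ q n := fun n =>
    Real.exp_le_exp.2 (neg_le_neg (hη.sum_le_tsum _ fun k _ => hη0 k))
  -- The discounted process plus the drift spent so far is a nonnegative supermartingale; its
  -- convergence controls both `V` and the sum of `D`.
  set U : ℕ → Ω → ℝ := fun n ω => q n * V n ω + ∑ k ∈ Finset.range n, q (k + 1) * D k ω with hU
  have hU0 : ∀ n ω, 0 ≤ U n ω := fun n ω => add_nonneg (mul_nonneg (hq0 n).le (hV0 n ω))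
    (Finset.sum_nonneg fun k _ => mul_nonneg (hq0 _).le (hD0 k ω))
  have hUi : ∀ n, Integrable (U n) P := fun n =>
    ((hVi n).const_mul _).add (integrable_finsetSum _ fun k _ => (hDi k).const_mul _)
  have hUm : StronglyAdapted ℱ U := by
    intro n
    refine ((hVm n).const_mul _).add (Finset.stronglyMeasurable_fun_sum _ fun k hk => ?_)
    exact ((hDm k).mono (ℱ.mono (Finset.mem_range.1 hk).le)).const_mul _
  have hstep : ∀ n, ∀ᵐ ω ∂P, U (n + 1) ω ≤ U n ω + q (n + 1) * m n ω := by
    intro n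
    filter_upwards [hV n] with ω hω
    simp only [hU, Finset.sum_range_succ]
    have h1 := mul_le_mul_of_nonneg_left hω (hq0 (n + 1)).le
    have h2 := mul_le_mul_of_nonneg_right (hqs n) (hV0 n ω)
    linarith
  have hsuper : Supermartingale U ℱ P := by
    refine supermartingale_nat hUm hUi fun n => ?_
    have h1 := condExp_mono (m := ℱ n) (hUi (n + 1))
      ((hUi n).add ((hmi n).const_mul (q (n + 1)))) (hstep n)
    have h2 := condExp_add (hUi n) ((hmi n).const_mul (q (n + 1))) (ℱ n)
    have h3 := condExp_smul (μ := P) (q (n + 1)) (m n) (ℱ n)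
    have h4 := condExp_of_stronglyMeasurable (ℱ.le n) (hUm n) (hUi n)
    have h3' : P[fun ω => q (n + 1) * m n ω | ℱ n] =ᵐ[P] q (n + 1) • P[m n | ℱ n] := h3
    filter_upwards [h1, h2, h3', hm n] with ω g1 g2 g3 g5
    refine g1.trans ?_
    rw [g2, Pi.add_apply, h4, g3, Pi.smul_apply, g5]
    simp
  -- Nonnegativity turns the L¹ norm into the expectation, which does not increase; the
  -- submartingale convergence theorem is then applied to `-U`.
  have hbd : ∀ n, eLpNorm ((-U) n) 1 P ≤ ((∫ ω, U 0 ω ∂P).toNNReal : ℝ≥0) := by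
    intro n
    rw [Pi.neg_apply, eLpNorm_neg, eLpNorm_one_eq_lintegral_enorm,
      ← ofReal_integral_norm_eq_lintegral_enorm (hUi n)]
    refine ENNReal.ofReal_le_ofReal ?_
    have h1 : ∫ ω, ‖U n ω‖ ∂P = ∫ ω, U n ω ∂P :=
      integral_congr_ae (Eventually.of_forall fun ω => Real.norm_of_nonneg (hU0 n ω))
    rw [h1]
    simpa using hsuper.setIntegral_le (Nat.zero_le n) MeasurableSet.univ
  filter_upwards [hsuper.neg.exists_ae_tendsto_of_bdd hbd] with ω ⟨c, hc⟩
  have hc' : Tendsto (fun n => U n ω) atTop (𝓝 (-c)) := by simpa using hc.neg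
  obtain ⟨B, hB⟩ := hc'.bddAbove_range
  have hsum : Summable fun k => q (k + 1) * D k ω := by
    refine summable_of_sum_range_le (c := B) (fun k => mul_nonneg (hq0 _).le (hD0 k ω)) fun n => ?_
    have h1 : U n ω ≤ B := hB ⟨n, rfl⟩
    have h2 := mul_nonneg (hq0 n).le (hV0 n ω)
    simp only [hU] at h1
    linarith
  refine ⟨⟨_, ((hc'.sub hsum.hasSum.tendsto_sum_nat).div hqlim (Real.exp_pos _).ne').congr
    fun n => ?_⟩, ?_⟩
  · simp only [hU, Pi.div_apply, add_sub_cancel_right]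
    exact mul_div_cancel_left₀ _ (hq0 n).ne'
  · refine Summable.of_nonneg_of_le (hD0 · ω) (fun k => ?_)
      (hsum.mul_left (Real.exp (-∑' k, η k))⁻¹)
    rw [← div_eq_inv_mul, le_div_iff₀ (Real.exp_pos _), mul_comm]
    exact mul_le_mul_of_nonneg_right (hqlow _) (hD0 k ω)

section Deterministic

variable {E G : Type*} [NormedAddCommGroup E] [InnerProductSpace ℝ E] [CompleteSpace E]
  [NormedAddCommGroup G] [InnerProductSpace ℝ G] [CompleteSpace G]

/-! ### Strongly antimonotone operators -/

/-- Cauchy–Schwarz with one factor ‖y - x‖ cancelled. It yields injectivity and the Lipschitz bound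
for the inverse of `f`. -/
lemma mul_norm_sub_le_of_strongAnti {E : Type*} [NormedAddCommGroup E] [InnerProductSpace ℝ E]
    {f : E → E} {c : ℝ}
    (hf : ∀ x y, inner ℝ (y - x) (f y - f x) ≤ -c * ‖y - x‖ ^ 2) (x y : E) :
    c * ‖y - x‖ ≤ ‖f y - f x‖ := by
  rcases (norm_nonneg (y - x)).eq_or_lt with h0 | h0
  · rw [← h0, mul_zero]; exact norm_nonneg _
  · have h1 := neg_le_of_abs_le (abs_real_inner_le_norm (y - x) (f y - f x))
    have h2 := hf x y
    refine le_of_mul_le_mul_left ?_ h0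
    linarith

/-- A Lipschitz strongly antimonotone operator on a Hilbert space is surjective. -/
lemma surjective_of_strongAnti {f : E → E} {c : ℝ} (hc : 0 < c)
    (hf : ∀ x y, inner ℝ (y - x) (f y - f x) ≤ -c * ‖y - x‖ ^ 2) {K : ℝ}
    (hK : ∀ x y, ‖f y - f x‖ ≤ K * ‖y - x‖) : Function.Surjective f := by
  intro p
  -- The step size must satisfy t·K² ≤ c and t·c < 1; the damped map `T` below then contracts with
  -- constant √(1 - t·c), and its fixed point solves f x = p.
  set t : ℝ := c / (K ^ 2 + c ^ 2 + 1) with ht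
  have hden : 0 < K ^ 2 + c ^ 2 + 1 := by positivity
  have ht0 : 0 < t := by positivity
  have htK : t * K ^ 2 ≤ c := by
    rw [ht, div_mul_eq_mul_div, div_le_iff₀ hden]
    nlinarith [pow_pos hc 3]
  have htc : t * c < 1 := by
    rw [ht, div_mul_eq_mul_div, div_lt_one hden]
    nlinarith [sq_nonneg K]
  set T : E → E := fun x => x + t • (f x - p) with hT
  have hsq : ∀ x y, ‖T y - T x‖ ^ 2 ≤ (1 - t * c) * ‖y - x‖ ^ 2 := by
    intro x y
    have e1 : T y - T x = (y - x) + t • (f y - f x) := by simp only [hT]; module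
    rw [e1, norm_add_sq_real, inner_smul_right, norm_smul, Real.norm_of_nonneg ht0.le, mul_pow]
    have h1 := mul_le_mul_of_nonneg_left (hf x y) ht0.le
    have h2 : ‖f y - f x‖ ^ 2 ≤ K ^ 2 * ‖y - x‖ ^ 2 := by
      rw [← mul_pow]; exact pow_le_pow_left₀ (norm_nonneg _) (hK x y) 2
    have h3 := mul_le_mul_of_nonneg_left h2 (sq_nonneg t)
    have h4 := mul_le_mul_of_nonneg_right (mul_le_mul_of_nonneg_left htK ht0.le)
      (sq_nonneg ‖y - x‖)
    linarith
  have hcontr : ContractingWith (Real.toNNReal √(1 - t * c)) T := by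
    constructor
    · rw [← Real.toNNReal_one, Real.toNNReal_lt_toNNReal_iff one_pos, Real.sqrt_lt' one_pos]
      nlinarith
    · refine LipschitzWith.of_dist_le_mul fun x y => ?_
      rw [dist_eq_norm, dist_eq_norm, Real.coe_toNNReal _ (Real.sqrt_nonneg _)]
      refine (sq_le_sq₀ (norm_nonneg _) (by positivity)).1 ?_
      rw [mul_pow, Real.sq_sqrt (by linarith)]
      exact hsq y x
  have hfix : T (ContractingWith.fixedPoint T hcontr) = ContractingWith.fixedPoint T hcontr :=
    hcontr.fixedPoint_isFixedPt
  refine ⟨ContractingWith.fixedPoint T hcontr, ?_⟩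
  have h1 : t • (f (ContractingWith.fixedPoint T hcontr) - p) = 0 := by
    simpa only [hT, add_eq_left] using hfix
  exact sub_eq_zero.1 ((smul_eq_zero.1 h1).resolve_left ht0.ne')

/-! ### Saddle systems -/

/-- The data of a primal-dual system `F x = L† y`, `L x = b` with solution `(xs, ys)`:
`h y` is the primal response to the dual variable `y`. -/
structure IsSaddleSystem (F : E → E) (L : E →L[ℝ] G) (b : G) (h : G → E) (xs : E) (ys : G)
    (lam ell mu H : ℝ) : Prop where
  lam_pos : 0 < lam
  ell_nonneg : 0 ≤ ell
  mu_pos : 0 < mu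
  H_nonneg : 0 ≤ H
  mono : ∀ x x', inner ℝ (x' - x) (F x' - F x) ≤ -lam * ‖x' - x‖ ^ 2
  lip : ∀ x x', ‖F x' - F x‖ ≤ ell * ‖x' - x‖
  F_h : ∀ y, F (h y) = L.adjoint y
  h_lip : ∀ y y', ‖h y' - h y‖ ≤ H * ‖y' - y‖
  dual_mono : ∀ y, inner ℝ (y - ys) (L (h y) - b) ≤ -mu * ‖y - ys‖ ^ 2
  h_ys : h ys = xs
  L_xs : L xs = b

/-- Existence of the primal response and of the equilibrium. -/
lemma exists_isSaddleSystem {F : E → E} {L : E →L[ℝ] G} (b : G) {lam ell κ : ℝ}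
    (hlam : 0 < lam) (hell : 0 < ell) (hκ : 0 < κ) (hL : ∀ y, κ * ‖y‖ ≤ ‖L.adjoint y‖)
    (mono : ∀ x x', inner ℝ (x' - x) (F x' - F x) ≤ -lam * ‖x' - x‖ ^ 2)
    (lip : ∀ x x', ‖F x' - F x‖ ≤ ell * ‖x' - x‖) :
    ∃ h xs ys, IsSaddleSystem F L b h xs ys lam ell (lam * κ ^ 2 / ell ^ 2) (‖L‖ / lam) := by
  choose h hh using fun y => surjective_of_strongAnti hlam mono lip (L.adjoint y)
  have h_lip : ∀ y y', ‖h y' - h y‖ ≤ ‖L‖ / lam * ‖y' - y‖ := by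
    intro y y'
    have h1 := mul_norm_sub_le_of_strongAnti mono (h y) (h y')
    rw [hh, hh, ← map_sub] at h1
    have h2 := L.adjoint.le_opNorm (y' - y)
    rw [LinearIsometryEquiv.norm_map] at h2
    rw [div_mul_eq_mul_div, le_div_iff₀ hlam, mul_comm]
    exact h1.trans h2
  have hmu : 0 < lam * κ ^ 2 / ell ^ 2 := by positivity
  -- Moving `L` across the inner product turns L†(y' - y) into F(h y') - F(h y), so monotonicity of
  -- `F` applies; κ‖y' - y‖ ≤ ell·‖h y' - h y‖ converts the modulus.
  have gmono : ∀ y y', inner ℝ (y' - y) ((L (h y') - b) - (L (h y) - b)) ≤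
      -(lam * κ ^ 2 / ell ^ 2) * ‖y' - y‖ ^ 2 := by
    intro y y'
    have e1 : inner ℝ (y' - y) ((L (h y') - b) - (L (h y) - b)) =
        inner ℝ (h y' - h y) (F (h y') - F (h y)) := by
      rw [sub_sub_sub_cancel_right, ← map_sub, hh, hh, ← map_sub,
        ← ContinuousLinearMap.adjoint_inner_left, real_inner_comm]
    rw [e1]
    refine (mono _ _).trans ?_
    have h1 := (hL (y' - y)).trans_eq (by rw [map_sub, ← hh, ← hh])
    have h2 := h1.trans (lip (h y) (h y'))
    have h3 := pow_le_pow_left₀ (by positivity) h2 2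
    rw [mul_pow, mul_pow] at h3
    have h4 : κ ^ 2 / ell ^ 2 * ‖y' - y‖ ^ 2 ≤ ‖h y' - h y‖ ^ 2 := by
      rw [div_mul_eq_mul_div, div_le_iff₀ (by positivity)]
      linarith
    have h5 := mul_le_mul_of_nonneg_left h4 hlam.le
    have e2 : lam * κ ^ 2 / ell ^ 2 * ‖y' - y‖ ^ 2 =
      lam * (κ ^ 2 / ell ^ 2 * ‖y' - y‖ ^ 2) := by ring
    linarith
  have glip : ∀ y y', ‖(L (h y') - b) - (L (h y) - b)‖ ≤ ‖L‖ * (‖L‖ / lam) * ‖y' - y‖ := by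
    intro y y'
    rw [sub_sub_sub_cancel_right, ← map_sub, mul_assoc]
    exact (L.le_opNorm _).trans (mul_le_mul_of_nonneg_left (h_lip y y') (norm_nonneg _))
  obtain ⟨ys, hys⟩ := surjective_of_strongAnti (f := fun y => L (h y) - b) hmu gmono glip 0
  refine ⟨h, h ys, ys, hlam, hell.le, hmu, by positivity, mono, lip, hh, h_lip, fun y => ?_, rfl,
    sub_eq_zero.1 hys⟩
  have := gmono ys y
  rwa [show L (h ys) - b = 0 from hys, sub_zero] at this

namespace IsSaddleSystem

variable {F : E → E} {L : E →L[ℝ] G} {b : G} {h : G → E} {xs : E} {ys : G} {lam ell mu H : ℝ}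

lemma F_injective (hS : IsSaddleSystem F L b h xs ys lam ell mu H) : Function.Injective F := by
  intro x x' hx
  have h1 := mul_norm_sub_le_of_strongAnti hS.mono x x'
  rw [hx, sub_self, norm_zero] at h1
  have h2 : ‖x' - x‖ ≤ 0 := nonpos_of_mul_nonpos_right h1 hS.lam_pos
  exact (sub_eq_zero.1 (norm_le_zero_iff.1 h2)).symm

lemma F_xs (hS : IsSaddleSystem F L b h xs ys lam ell mu H) : F xs = L.adjoint ys := by
  rw [← hS.h_ys, hS.F_h]

lemma solution_iff (hS : IsSaddleSystem F L b h xs ys lam ell mu H) (x : E) (y : G) :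
    (L x = b ∧ F x = L.adjoint y) ↔ (x = xs ∧ y = ys) := by
  constructor
  · rintro ⟨h1, h2⟩
    have hx : x = h y := hS.F_injective (h2.trans (hS.F_h y).symm)
    have h3 := hS.dual_mono y
    rw [← hx, h1, sub_self, inner_zero_right] at h3
    have h4 : ‖y - ys‖ ^ 2 ≤ 0 := by nlinarith [hS.mu_pos]
    have h5 : y = ys := by
      rw [← sub_eq_zero, ← norm_eq_zero]; exact pow_eq_zero_iff two_ne_zero |>.1
        (le_antisymm h4 (sq_nonneg _))
    exact ⟨by rw [hx, h5, hS.h_ys], h5⟩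
  · rintro ⟨rfl, rfl⟩
    exact ⟨hS.L_xs, hS.F_xs⟩

/-- Triangle inequality through the response h(y): small gaps force x to be close to the
equilibrium. -/
lemma norm_sub_xs_le (hS : IsSaddleSystem F L b h xs ys lam ell mu H) (x : E) (y : G) :
    ‖x - xs‖ ≤ ‖x - h y‖ + H * ‖y - ys‖ := by
  have h1 := hS.h_lip ys y
  rw [hS.h_ys] at h1
  exact (norm_sub_le_norm_sub_add_norm_sub x (h y) xs).trans (by linarith)

lemma norm_L_sub_le (hS : IsSaddleSystem F L b h xs ys lam ell mu H) (x : E) :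
    ‖L x - b‖ ≤ ‖L‖ * ‖x - xs‖ := by
  rw [← hS.L_xs, ← map_sub]; exact L.le_opNorm _

/-- Expresses the linear growth of the noise in terms of the gaps, so that the recursions close. -/
lemma growth_le (hS : IsSaddleSystem F L b h xs ys lam ell mu H) (x : E) (y : G) :
    1 + ‖x‖ + ‖y‖ ≤ (1 + ‖xs‖ + ‖ys‖ + H) * (1 + ‖x - h y‖ + ‖y - ys‖) := by
  have h1 := hS.norm_sub_xs_le x y
  have h2 := norm_le_norm_sub_add x xs
  have h3 := norm_le_norm_sub_add y ys
  have := hS.H_nonneg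
  have := norm_nonneg xs
  have := norm_nonneg ys
  have := norm_nonneg (x - h y)
  have := norm_nonneg (y - ys)
  nlinarith [mul_nonneg (norm_nonneg xs) (norm_nonneg (x - h y)),
    mul_nonneg (norm_nonneg xs) (norm_nonneg (y - ys)),
    mul_nonneg (norm_nonneg ys) (norm_nonneg (x - h y)),
    mul_nonneg (norm_nonneg ys) (norm_nonneg (y - ys)),
    mul_nonneg hS.H_nonneg (norm_nonneg (x - h y))]

lemma one_add_add_sq_le (s t : ℝ) : (1 + s + t) ^ 2 ≤ 3 * (1 + s ^ 2 + t ^ 2) := by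
  nlinarith [sq_nonneg (1 - s), sq_nonneg (1 - t), sq_nonneg (s - t)]

/-- The dual increment grows at most linearly in the primal and dual gaps. -/
lemma dual_increment_le (hS : IsSaddleSystem F L b h xs ys lam ell mu H) {s₀ β₀ κ : ℝ}
    (hs₀ : 0 ≤ s₀) (hβ₀ : 0 ≤ β₀) (hκ : 0 ≤ κ) {x : E} {y N' : G}
    (hN : ‖N'‖ ≤ κ * (1 + ‖x‖ + ‖y‖)) :
    ‖s₀ • (L x - b) + β₀ • N'‖ ≤
      (s₀ * (‖L‖ * (1 + H)) + β₀ * (κ * (1 + ‖xs‖ + ‖ys‖ + H))) *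
        (1 + ‖x - h y‖ + ‖y - ys‖) := by
  have h1 : ‖L x - b‖ ≤ ‖L‖ * (1 + H) * (1 + ‖x - h y‖ + ‖y - ys‖) := by
    refine (hS.norm_L_sub_le x).trans ?_
    rw [mul_assoc]
    refine mul_le_mul_of_nonneg_left ((hS.norm_sub_xs_le x y).trans ?_) (norm_nonneg _)
    nlinarith [norm_nonneg (x - h y), norm_nonneg (y - ys), hS.H_nonneg,
      mul_nonneg hS.H_nonneg (norm_nonneg (x - h y))]
  have h2 := hN.trans (mul_le_mul_of_nonneg_left (hS.growth_le x y) hκ)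
  refine (norm_add_le _ _).trans ?_
  rw [norm_smul, norm_smul, Real.norm_of_nonneg hs₀, Real.norm_of_nonneg hβ₀]
  have h3 := mul_le_mul_of_nonneg_left h1 hs₀
  have h4 := mul_le_mul_of_nonneg_left h2 hβ₀
  linarith

/-- One step of the slow (dual) recursion. -/
lemma dual_step (hS : IsSaddleSystem F L b h xs ys lam ell mu H) {s₀ β₀ κ : ℝ}
    (hs₀ : 0 < s₀) (hβ₀ : 0 < β₀) (hκ : 0 < κ) :
    ∃ C, 0 ≤ C ∧ ∀ (σ : ℝ) (x : E) (y N' : G), 0 < σ →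
      ‖N'‖ ≤ κ * (1 + ‖x‖ + ‖y‖) →
      ‖y + (s₀ * σ) • (L x - b) + (β₀ * σ) • N' - ys‖ ^ 2 ≤
        (1 - mu * s₀ * σ) * ‖y - ys‖ ^ 2 + ‖L‖ ^ 2 / mu * s₀ * σ * ‖x - h y‖ ^ 2
        + 2 * β₀ * σ * inner ℝ (y - ys) N'
        + C * σ ^ 2 * (1 + ‖x - h y‖ ^ 2 + ‖y - ys‖ ^ 2) := by
  have hH := hS.H_nonneg
  set c := s₀ * (‖L‖ * (1 + H)) + β₀ * (κ * (1 + ‖xs‖ + ‖ys‖ + H)) with hc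
  have hc0 : 0 ≤ c := by positivity
  refine ⟨3 * c ^ 2, by positivity, fun σ x y N' hσ hN => ?_⟩
  have e1 : y + (s₀ * σ) • (L x - b) + (β₀ * σ) • N' - ys =
      (y - ys) + σ • (s₀ • (L x - b) + β₀ • N') := by module
  rw [e1, norm_add_sq_real, inner_smul_right, inner_add_right, inner_smul_right, inner_smul_right,
    norm_smul, Real.norm_of_nonneg hσ.le, mul_pow]
  have h1 : ‖s₀ • (L x - b) + β₀ • N'‖ ^ 2 ≤
      c ^ 2 * (3 * (1 + ‖x - h y‖ ^ 2 + ‖y - ys‖ ^ 2)) := by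
    refine (pow_le_pow_left₀ (norm_nonneg _)
      (hS.dual_increment_le hs₀.le hβ₀.le hκ.le hN) 2).trans ?_
    rw [mul_pow]
    exact mul_le_mul_of_nonneg_left (one_add_add_sq_le _ _) (sq_nonneg _)
  -- Splitting at h(y), the reduced dual map contributes -2·mu; Young's inequality spends one `mu`
  -- on the error `L (x - h y)`.
  have h2 : 2 * inner ℝ (y - ys) (L x - b) ≤
      -mu * ‖y - ys‖ ^ 2 + ‖L‖ ^ 2 / mu * ‖x - h y‖ ^ 2 := by
    have e2 : L x - b = L (x - h y) + (L (h y) - b) := by rw [map_sub]; abel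
    rw [e2, inner_add_right]
    have g1 := hS.dual_mono y
    have g2 : inner ℝ (y - ys) (L (x - h y)) ≤ ‖y - ys‖ * (‖L‖ * ‖x - h y‖) :=
      (real_inner_le_norm _ _).trans
        (mul_le_mul_of_nonneg_left (L.le_opNorm _) (norm_nonneg _))
    have g3 : 2 * (‖y - ys‖ * (‖L‖ * ‖x - h y‖)) ≤
        mu * ‖y - ys‖ ^ 2 + ‖L‖ ^ 2 / mu * ‖x - h y‖ ^ 2 := by
      have hmu := hS.mu_pos
      have e3 : mu * ‖y - ys‖ ^ 2 + ‖L‖ ^ 2 / mu * ‖x - h y‖ ^ 2 -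
          2 * (‖y - ys‖ * (‖L‖ * ‖x - h y‖)) =
          (mu * ‖y - ys‖ - ‖L‖ * ‖x - h y‖) ^ 2 / mu := by field_simp; ring
      have : 0 ≤ (mu * ‖y - ys‖ - ‖L‖ * ‖x - h y‖) ^ 2 / mu := by positivity
      linarith
    linarith
  have h3 := mul_le_mul_of_nonneg_left h1 (sq_nonneg σ)
  have h4 := mul_le_mul_of_nonneg_left h2 (mul_pos hs₀ hσ).le
  linarith

/-- The noiseless primal step towards `h y`. -/
def primalDrift (F : E → E) (h : G → E) (a : ℝ) (x : E) (y : G) : E :=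
  (x - h y) + a • (F x - F (h y))

/-- Expanding the square, strong monotonicity gives the gain linear in `a` and the Lipschitz bound
the quadratic loss. -/
lemma norm_primalDrift_sq_le (hS : IsSaddleSystem F L b h xs ys lam ell mu H) {a : ℝ}
    (ha : 0 ≤ a) (x : E) (y : G) :
    ‖primalDrift F h a x y‖ ^ 2 ≤
      (1 - 2 * (a * lam) + a ^ 2 * ell ^ 2) * ‖x - h y‖ ^ 2 := by
  unfold primalDrift
  rw [norm_add_sq_real, inner_smul_right, norm_smul, Real.norm_of_nonneg ha, mul_pow]
  have h1 := mul_le_mul_of_nonneg_left (hS.mono (h y) x) ha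
  have h2 := pow_le_pow_left₀ (norm_nonneg _) (hS.lip (h y) x) 2
  rw [mul_pow] at h2
  have h3 := mul_le_mul_of_nonneg_left h2 (sq_nonneg a)
  linarith

-- Young's inequality is applied to ⟨w, e⟩ only; ⟨w, n⟩ is kept exactly, since for noise `n` it has
-- conditional mean zero.
omit [CompleteSpace E] in
lemma norm_add_add_sq_le {w n e : E} {ε : ℝ} (hε : 0 < ε) :
    ‖w + n + e‖ ^ 2 ≤
      (1 + ε) * ‖w‖ ^ 2 + 2 * inner ℝ w n + ‖e‖ ^ 2 / ε + 2 * ‖n‖ ^ 2 + 2 * ‖e‖ ^ 2 := by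
  rw [add_assoc, norm_add_sq_real, inner_add_right]
  have h1 : ‖n + e‖ ^ 2 ≤ 2 * ‖n‖ ^ 2 + 2 * ‖e‖ ^ 2 := by
    refine (pow_le_pow_left₀ (norm_nonneg _) (norm_add_le n e) 2).trans ?_
    nlinarith [sq_nonneg (‖n‖ - ‖e‖)]
  have h2 := real_inner_le_norm w e
  have h3 : ε * ‖w‖ ^ 2 + ‖e‖ ^ 2 / ε - 2 * (‖w‖ * ‖e‖) = (ε * ‖w‖ - ‖e‖) ^ 2 / ε := by
    field_simp; ring
  have h4 : 0 ≤ (ε * ‖w‖ - ‖e‖) ^ 2 / ε := by positivity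
  linarith

/-- One step of the fast (primal) recursion. -/
lemma primal_step (hS : IsSaddleSystem F L b h xs ys lam ell mu H) {a₀ α₀ s₀ β₀ κ : ℝ}
    (ha₀ : 0 < a₀) (hα₀ : 0 < α₀) (hs₀ : 0 < s₀) (hβ₀ : 0 < β₀) (hκ : 0 < κ) :
    ∃ C, 0 ≤ C ∧ ∀ (r σ : ℝ) (x N : E) (y N' : G), 0 < σ → σ ≤ r → r ≤ 1 → σ ^ 2 = r ^ 3 →
      ‖N‖ + ‖N'‖ ≤ κ * (1 + ‖x‖ + ‖y‖) →
      ‖x + (a₀ * r) • (F x - L.adjoint y) + (α₀ * r) • N -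
          h (y + (s₀ * σ) • (L x - b) + (β₀ * σ) • N')‖ ^ 2 ≤
        (1 - lam * a₀ * r) * ‖x - h y‖ ^ 2
        + 2 * α₀ * r * inner ℝ (primalDrift F h (a₀ * r) x y) N
        + C * r ^ 2 * (1 + ‖x - h y‖ ^ 2 + ‖y - ys‖ ^ 2) := by
  have hH := hS.H_nonneg
  have hlam := hS.lam_pos
  set D := κ * (1 + ‖xs‖ + ‖ys‖ + H) with hD
  have hD0 : 0 ≤ D := by positivity
  set c := s₀ * (‖L‖ * (1 + H)) + β₀ * D with hc
  have hc0 : 0 ≤ c := by positivity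
  refine ⟨a₀ ^ 2 * ell ^ 2 * (1 + a₀ * lam) +
    (H * c) ^ 2 * 3 / (a₀ * lam) + 2 * α₀ ^ 2 * (D ^ 2 * 3) + 2 * ((H * c) ^ 2 * 3),
    by positivity, fun r σ x N y N' hσ hσr hr1 hσ2 hN => ?_⟩
  have hr : 0 < r := hσ.trans_le hσr
  set z := ‖x - h y‖ with hz
  set v := ‖y - ys‖ with hv
  set q := 1 + z ^ 2 + v ^ 2 with hq
  set y₁ := y + (s₀ * σ) • (L x - b) + (β₀ * σ) • N' with hy₁
  have hq0 : 0 ≤ q := by positivity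
  have hNq : ‖N‖ ^ 2 ≤ D ^ 2 * 3 * q := by
    have g1 : ‖N‖ ≤ D * (1 + z + v) := by
      have := mul_le_mul_of_nonneg_left (hS.growth_le x y) hκ.le
      have := norm_nonneg N'
      rw [hD, mul_assoc]
      linarith
    refine (pow_le_pow_left₀ (norm_nonneg _) g1 2).trans ?_
    rw [mul_pow, mul_assoc]
    exact mul_le_mul_of_nonneg_left (one_add_add_sq_le _ _) (sq_nonneg _)
  have he : ‖h y - h y₁‖ ^ 2 ≤ σ ^ 2 * ((H * c) ^ 2 * 3 * q) := by
    have g1 : ‖y - y₁‖ ≤ σ * (c * (1 + z + v)) := by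
      have e1 : y - y₁ = -(σ • (s₀ • (L x - b) + β₀ • N')) := by rw [hy₁]; module
      rw [e1, norm_neg, norm_smul, Real.norm_of_nonneg hσ.le]
      refine mul_le_mul_of_nonneg_left (hS.dual_increment_le hs₀.le hβ₀.le hκ.le ?_) hσ.le
      linarith [norm_nonneg N]
    have g2 := (hS.h_lip y₁ y).trans (mul_le_mul_of_nonneg_left g1 hH)
    refine (pow_le_pow_left₀ (norm_nonneg _) g2 2).trans ?_
    have g3 := mul_le_mul_of_nonneg_left (one_add_add_sq_le z v) (sq_nonneg (H * c * σ))
    linarith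
  -- The choice of exponents enters here: σ²/r = r².
  have he' : ‖h y - h y₁‖ ^ 2 / (a₀ * r * lam) ≤ r ^ 2 * ((H * c) ^ 2 * 3 / (a₀ * lam) * q) := by
    rw [div_le_iff₀ (by positivity)]
    refine he.trans_eq ?_
    rw [hσ2]; field_simp
  have he2 : ‖h y - h y₁‖ ^ 2 ≤ r ^ 2 * ((H * c) ^ 2 * 3 * q) :=
    he.trans (mul_le_mul_of_nonneg_right (pow_le_pow_left₀ hσ.le hσr 2) (by positivity))
  have e2 : x + (a₀ * r) • (F x - L.adjoint y) + (α₀ * r) • N - h y₁ =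
      primalDrift F h (a₀ * r) x y + (α₀ * r) • N + (h y - h y₁) := by
    rw [primalDrift, hS.F_h]; module
  rw [e2]
  -- This ε gives up half of the contraction: (1 + ε)(1 - 2ε) ≤ 1 - ε.
  refine (norm_add_add_sq_le (ε := a₀ * r * lam) (by positivity)).trans ?_
  rw [inner_smul_right, norm_smul, Real.norm_of_nonneg (by positivity), mul_pow]
  have hw := mul_le_mul_of_nonneg_left
    (hS.norm_primalDrift_sq_le (a := a₀ * r) (by positivity) x y)
    (by positivity : 0 ≤ 1 + a₀ * r * lam)
  have hw2 : (1 + a₀ * r * lam) *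
      ((1 - 2 * (a₀ * r * lam) + (a₀ * r) ^ 2 * ell ^ 2) * z ^ 2) ≤
      (1 - lam * a₀ * r) * z ^ 2 + r ^ 2 * (a₀ ^ 2 * ell ^ 2 * (1 + a₀ * lam) * q) := by
    have hzq : z ^ 2 ≤ q := by rw [hq]; linarith [sq_nonneg v]
    have g1 : (1 + a₀ * r * lam) * ((a₀ * r) ^ 2 * ell ^ 2 * z ^ 2) ≤
        (1 + a₀ * lam) * ((a₀ * r) ^ 2 * ell ^ 2 * q) := by
      refine mul_le_mul ?_ (mul_le_mul_of_nonneg_left hzq (by positivity)) (by positivity)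
        (by positivity)
      have := mul_le_mul_of_nonneg_left hr1 (mul_pos ha₀ hlam).le
      linarith
    have g2 : 0 ≤ 2 * (a₀ * r * lam) ^ 2 * z ^ 2 := by positivity
    linarith
  have hn := mul_le_mul_of_nonneg_left hNq (sq_nonneg (α₀ * r))
  linarith

end IsSaddleSystem

end Deterministic

section Stochastic

variable {E G Ω : Type*} [NormedAddCommGroup E] [InnerProductSpace ℝ E] [CompleteSpace E]
  [NormedAddCommGroup G] [InnerProductSpace ℝ G] [CompleteSpace G]
  {m0 : MeasurableSpace Ω} {P : Measure Ω}

/-! ### Square-integrable vectors -/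

omit [CompleteSpace E] in
lemma integrable_inner_of_memLp {f g : Ω → E} (hf : MemLp f 2 P) (hg : MemLp g 2 P) :
    Integrable (fun ω => inner ℝ (f ω) (g ω)) P := by
  refine (hf.norm.integrable_mul hg.norm).mono (hf.1.inner hg.1) (Eventually.of_forall fun ω => ?_)
  simpa using abs_real_inner_le_norm (f ω) (g ω)

/-- The known factor is pulled out of the conditional expectation; square integrability of both
factors makes the product integrable. -/
lemma condExp_inner_eq_zero {m : MeasurableSpace Ω} [IsFiniteMeasure P] {f g : Ω → E}
    (hfm : StronglyMeasurable[m] f) (hf : MemLp f 2 P) (hg : MemLp g 2 P)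
    (h : P[g | m] =ᵐ[P] 0) : P[fun ω => inner ℝ (f ω) (g ω) | m] =ᵐ[P] 0 := by
  have h1 := condExp_bilin_of_stronglyMeasurable_left (μ := P) (m := m)
    (innerSL ℝ : E →L[ℝ] E →L[ℝ] ℝ) hfm (integrable_inner_of_memLp hf hg)
    (hg.integrable one_le_two)
  filter_upwards [h1, h] with ω g1 g2
  have g3 : (P[fun ω => inner ℝ (f ω) (g ω) | m]) ω = _ := g1
  rw [g3, g2]
  simp

omit [InnerProductSpace ℝ E] [InnerProductSpace ℝ G] [CompleteSpace E] [CompleteSpace G] in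
lemma memLp_comp_of_lipschitz [IsFiniteMeasure P] {f : E → G} {K : ℝ}
    (hf : ∀ x x', ‖f x' - f x‖ ≤ K * ‖x' - x‖) {u : Ω → E} (hu : MemLp u 2 P) :
    MemLp (fun ω => f (u ω)) 2 P := by
  have hc : Continuous f := (LipschitzWith.of_dist_le_mul (K := K.toNNReal) fun x y => by
    rw [dist_eq_norm, dist_eq_norm]
    exact (hf y x).trans (mul_le_mul_of_nonneg_right (Real.le_coe_toNNReal K)
      (norm_nonneg _))).continuous
  have h1 : MemLp (fun ω => ‖f 0‖ + K * ‖u ω‖) 2 P :=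
    (memLp_const ‖f 0‖).add (hu.norm.const_mul K)
  refine h1.of_le (hc.comp_aestronglyMeasurable hu.1) (Eventually.of_forall fun ω => ?_)
  refine le_trans ?_ (le_abs_self _)
  have := hf 0 (u ω)
  rw [sub_zero] at this
  linarith [norm_le_norm_add_norm_sub' (f (u ω)) (f 0)]

lemma IsSaddleSystem.F_continuous {F : E → E} {L : E →L[ℝ] G} {b : G} {h : G → E} {xs : E} {ys : G}
    {lam ell mu H : ℝ} (hS : IsSaddleSystem F L b h xs ys lam ell mu H) : Continuous F :=
  (LipschitzWith.of_dist_le_mul (K := ell.toNNReal) fun x y => by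
    rw [dist_eq_norm, dist_eq_norm, Real.coe_toNNReal _ hS.ell_nonneg]
    exact hS.lip y x).continuous

lemma IsSaddleSystem.h_continuous {F : E → E} {L : E →L[ℝ] G} {b : G} {h : G → E} {xs : E} {ys : G}
    {lam ell mu H : ℝ} (hS : IsSaddleSystem F L b h xs ys lam ell mu H) : Continuous h :=
  (LipschitzWith.of_dist_le_mul (K := H.toNNReal) fun x y => by
    rw [dist_eq_norm, dist_eq_norm, Real.coe_toNNReal _ hS.H_nonneg]
    exact hS.h_lip y x).continuous

/-! ### The stochastic iteration -/

/-- The two-time-scale primal-dual iteration with martingale noise; `N n` and `N' n` are the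
noises of step `n`. -/
structure IsSaddleIteration (F : E → E) (L : E →L[ℝ] G) (b : G) (a₀ α₀ s₀ β₀ κ : ℝ)
    (P : Measure Ω) (ℱ : Filtration ℕ m0) (N : ℕ → Ω → E) (N' : ℕ → Ω → G)
    (x : ℕ → Ω → E) (y : ℕ → Ω → G) : Prop where
  init : StronglyMeasurable[ℱ 0] (x 0)
  init' : StronglyMeasurable[ℱ 0] (y 0)
  noise : ∀ n, StronglyMeasurable[ℱ (n + 1)] (N n)
  noise' : ∀ n, StronglyMeasurable[ℱ (n + 1)] (N' n)
  integrable : ∀ n, Integrable (N n) P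
  integrable' : ∀ n, Integrable (N' n) P
  condExp : ∀ n, P[N n | ℱ n] =ᵐ[P] 0
  condExp' : ∀ n, P[N' n | ℱ n] =ᵐ[P] 0
  growth : ∀ n, ∀ᵐ ω ∂P, ‖N n ω‖ + ‖N' n ω‖ ≤ κ * (1 + ‖x n ω‖ + ‖y n ω‖)
  primal : ∀ n ω, x (n + 1) ω = x n ω + (a₀ * fastScale n) • (F (x n ω) - L.adjoint (y n ω)) +
    (α₀ * fastScale n) • N n ω
  dual : ∀ n ω, y (n + 1) ω = y n ω + (s₀ * slowScale n) • (L (x n ω) - b) +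
    (β₀ * slowScale n) • N' n ω

namespace IsSaddleIteration

variable {F : E → E} {L : E →L[ℝ] G} {b : G} {h : G → E} {xs : E} {ys : G} {lam ell mu H : ℝ}
  {a₀ α₀ s₀ β₀ κ : ℝ} {ℱ : Filtration ℕ m0} {N : ℕ → Ω → E} {N' : ℕ → Ω → G}
  {x : ℕ → Ω → E} {y : ℕ → Ω → G}

lemma adapted (hI : IsSaddleIteration F L b a₀ α₀ s₀ β₀ κ P ℱ N N' x y) (hF : Continuous F) :
    StronglyAdapted ℱ x ∧ StronglyAdapted ℱ y := by
  have key : ∀ n, StronglyMeasurable[ℱ n] (x n) ∧ StronglyMeasurable[ℱ n] (y n) := by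
    intro n
    induction n with
    | zero => exact ⟨hI.init, hI.init'⟩
    | succ n ih =>
      have hx := ih.1.mono (ℱ.mono n.le_succ)
      have hy := ih.2.mono (ℱ.mono n.le_succ)
      constructor
      · have h1 : StronglyMeasurable[ℱ (n + 1)] fun ω => F (x n ω) :=
          hF.comp_stronglyMeasurable hx
        have h2 : StronglyMeasurable[ℱ (n + 1)] fun ω => L.adjoint (y n ω) :=
          L.adjoint.continuous.comp_stronglyMeasurable hy
        have h3 : StronglyMeasurable[ℱ (n + 1)]
            fun ω => (a₀ * fastScale n) • (F (x n ω) - L.adjoint (y n ω)) :=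
          (h1.sub h2).const_smul _
        have h4 : StronglyMeasurable[ℱ (n + 1)] fun ω => (α₀ * fastScale n) • N n ω :=
          (hI.noise n).const_smul _
        rw [funext (hI.primal n)]
        exact (hx.add h3).add h4
      · have h1 : StronglyMeasurable[ℱ (n + 1)] fun ω => L (x n ω) :=
          L.continuous.comp_stronglyMeasurable hx
        have h3 : StronglyMeasurable[ℱ (n + 1)]
            fun ω => (s₀ * slowScale n) • (L (x n ω) - b) :=
          (h1.sub stronglyMeasurable_const).const_smul _
        have h4 : StronglyMeasurable[ℱ (n + 1)] fun ω => (β₀ * slowScale n) • N' n ω :=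
          (hI.noise' n).const_smul _
        rw [funext (hI.dual n)]
        exact (hy.add h3).add h4
  exact ⟨fun n => (key n).1, fun n => (key n).2⟩

lemma memLp_noise [IsFiniteMeasure P] (hI : IsSaddleIteration F L b a₀ α₀ s₀ β₀ κ P ℱ N N' x y)
    {n : ℕ} (hx : MemLp (x n) 2 P) (hy : MemLp (y n) 2 P) :
    MemLp (N n) 2 P ∧ MemLp (N' n) 2 P := by
  have h1 : MemLp (fun ω => κ * (1 + ‖x n ω‖ + ‖y n ω‖)) 2 P :=
    (((memLp_const (1 : ℝ)).add hx.norm).add hy.norm).const_mul κ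
  constructor
  · refine h1.of_le (hI.integrable n).1 ?_
    filter_upwards [hI.growth n] with ω hω
    exact le_trans (by linarith [norm_nonneg (N' n ω)]) (le_abs_self _)
  · refine h1.of_le (hI.integrable' n).1 ?_
    filter_upwards [hI.growth n] with ω hω
    exact le_trans (by linarith [norm_nonneg (N n ω)]) (le_abs_self _)

/-- The noise is assumed only integrable; its linear growth in the iterates makes second moments
propagate by induction. -/
lemma memLp [IsFiniteMeasure P] (hI : IsSaddleIteration F L b a₀ α₀ s₀ β₀ κ P ℱ N N' x y)
    (hS : IsSaddleSystem F L b h xs ys lam ell mu H)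
    (hx0 : MemLp (x 0) 2 P) (hy0 : MemLp (y 0) 2 P) (n : ℕ) :
    MemLp (x n) 2 P ∧ MemLp (y n) 2 P := by
  induction n with
  | zero => exact ⟨hx0, hy0⟩
  | succ n ih =>
    obtain ⟨hx, hy⟩ := ih
    obtain ⟨hN, hN'⟩ := hI.memLp_noise hx hy
    constructor
    · rw [funext (hI.primal n)]
      exact (hx.add (((memLp_comp_of_lipschitz hS.lip hx).sub
        (L.adjoint.comp_memLp' hy)).const_smul _)).add (hN.const_smul _)
    · rw [funext (hI.dual n)]
      exact (hy.add (((L.comp_memLp' hx).sub (memLp_const b)).const_smul _)).add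
        (hN'.const_smul _)

/-- The martingale difference in the primal recursion. -/
def primalMart (F : E → E) (h : G → E) (a₀ α₀ : ℝ) (N : ℕ → Ω → E)
    (x : ℕ → Ω → E) (y : ℕ → Ω → G) (n : ℕ) (ω : Ω) : ℝ :=
  2 * α₀ * fastScale n *
    inner ℝ (IsSaddleSystem.primalDrift F h (a₀ * fastScale n) (x n ω) (y n ω)) (N n ω)

/-- The martingale difference in the dual recursion. -/
def dualMart (ys : G) (β₀ : ℝ) (N' : ℕ → Ω → G) (y : ℕ → Ω → G) (n : ℕ) (ω : Ω) : ℝ :=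
  2 * β₀ * slowScale n * inner ℝ (y n ω - ys) (N' n ω)

lemma condExp_const_mul_eq_zero {m : MeasurableSpace Ω} {f : Ω → ℝ} (c : ℝ)
    (hf : P[f | m] =ᵐ[P] 0) : P[fun ω => c * f ω | m] =ᵐ[P] 0 := by
  have h1 : P[fun ω => c * f ω | m] =ᵐ[P] c • P[f | m] := condExp_smul c f m
  filter_upwards [h1, hf] with ω g1 g2
  rw [g1, Pi.smul_apply, g2]
  simp

lemma primalMart_spec [IsFiniteMeasure P]
    (hI : IsSaddleIteration F L b a₀ α₀ s₀ β₀ κ P ℱ N N' x y)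
    (hS : IsSaddleSystem F L b h xs ys lam ell mu H)
    (hx0 : MemLp (x 0) 2 P) (hy0 : MemLp (y 0) 2 P) (n : ℕ) :
    Integrable (primalMart F h a₀ α₀ N x y n) P ∧
      P[primalMart F h a₀ α₀ N x y n | ℱ n] =ᵐ[P] 0 := by
  obtain ⟨hx, hy⟩ := hI.memLp hS hx0 hy0 n
  obtain ⟨hN, -⟩ := hI.memLp_noise hx hy
  obtain ⟨hxm, hym⟩ := hI.adapted hS.F_continuous
  have hhy := memLp_comp_of_lipschitz hS.h_lip hy
  have hw : MemLp (fun ω => IsSaddleSystem.primalDrift F h (a₀ * fastScale n) (x n ω) (y n ω)) 2 P :=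
    (hx.sub hhy).add (((memLp_comp_of_lipschitz hS.lip hx).sub
      (memLp_comp_of_lipschitz hS.lip hhy)).const_smul _)
  have hhm := hS.h_continuous.comp_stronglyMeasurable (hym n)
  have hwm : StronglyMeasurable[ℱ n]
      (fun ω => IsSaddleSystem.primalDrift F h (a₀ * fastScale n) (x n ω) (y n ω)) :=
    ((hxm n).sub hhm).add (((hS.F_continuous.comp_stronglyMeasurable (hxm n)).sub
      (hS.F_continuous.comp_stronglyMeasurable hhm)).const_smul _)
  exact ⟨(integrable_inner_of_memLp hw hN).const_mul _,
    condExp_const_mul_eq_zero _ (condExp_inner_eq_zero hwm hw hN (hI.condExp n))⟩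

lemma dualMart_spec [IsFiniteMeasure P]
    (hI : IsSaddleIteration F L b a₀ α₀ s₀ β₀ κ P ℱ N N' x y)
    (hS : IsSaddleSystem F L b h xs ys lam ell mu H)
    (hx0 : MemLp (x 0) 2 P) (hy0 : MemLp (y 0) 2 P) (n : ℕ) :
    Integrable (dualMart ys β₀ N' y n) P ∧ P[dualMart ys β₀ N' y n | ℱ n] =ᵐ[P] 0 := by
  obtain ⟨hx, hy⟩ := hI.memLp hS hx0 hy0 n
  obtain ⟨-, hN'⟩ := hI.memLp_noise hx hy
  obtain ⟨-, hym⟩ := hI.adapted hS.F_continuous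
  have hv := hy.sub (memLp_const ys)
  exact ⟨(integrable_inner_of_memLp hv hN').const_mul _,
    condExp_const_mul_eq_zero _ (condExp_inner_eq_zero
      ((hym n).sub stronglyMeasurable_const) hv hN' (hI.condExp' n))⟩

/-- The squared distance of the primal iterate to the primal response. -/
def primalGap (h : G → E) (x : ℕ → Ω → E) (y : ℕ → Ω → G) (n : ℕ) (ω : Ω) : ℝ :=
  ‖x n ω - h (y n ω)‖ ^ 2

/-- The squared distance of the dual iterate to the equilibrium. -/
def dualGap (ys : G) (y : ℕ → Ω → G) (n : ℕ) (ω : Ω) : ℝ := ‖y n ω - ys‖ ^ 2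

omit [InnerProductSpace ℝ E] [NormedAddCommGroup G] [InnerProductSpace ℝ G] [CompleteSpace E]
  [CompleteSpace G] in
lemma primalGap_nonneg (h : G → E) (x : ℕ → Ω → E) (y : ℕ → Ω → G) (n : ℕ) (ω : Ω) :
    0 ≤ primalGap h x y n ω := sq_nonneg _

omit [InnerProductSpace ℝ G] [CompleteSpace G] in
lemma dualGap_nonneg (ys : G) (y : ℕ → Ω → G) (n : ℕ) (ω : Ω) : 0 ≤ dualGap ys y n ω :=
  sq_nonneg _

lemma integrable_gaps [IsFiniteMeasure P]
    (hI : IsSaddleIteration F L b a₀ α₀ s₀ β₀ κ P ℱ N N' x y)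
    (hS : IsSaddleSystem F L b h xs ys lam ell mu H)
    (hx0 : MemLp (x 0) 2 P) (hy0 : MemLp (y 0) 2 P) (n : ℕ) :
    Integrable (primalGap h x y n) P ∧ Integrable (dualGap ys y n) P := by
  obtain ⟨hx, hy⟩ := hI.memLp hS hx0 hy0 n
  exact ⟨(hx.sub (memLp_comp_of_lipschitz hS.h_lip hy)).integrable_norm_pow two_ne_zero,
    (hy.sub (memLp_const ys)).integrable_norm_pow two_ne_zero⟩

lemma adapted_gaps (hI : IsSaddleIteration F L b a₀ α₀ s₀ β₀ κ P ℱ N N' x y)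
    (hS : IsSaddleSystem F L b h xs ys lam ell mu H) :
    StronglyAdapted ℱ (primalGap h x y) ∧ StronglyAdapted ℱ (dualGap ys y) := by
  obtain ⟨hxm, hym⟩ := hI.adapted hS.F_continuous
  exact ⟨fun n => ((hxm n).sub (hS.h_continuous.comp_stronglyMeasurable (hym n))).norm.pow 2,
    fun n => ((hym n).sub stronglyMeasurable_const).norm.pow 2⟩

/-- The coupled recursions of the two gaps. -/
lemma exists_gap_recursion (hI : IsSaddleIteration F L b a₀ α₀ s₀ β₀ κ P ℱ N N' x y)
    (hS : IsSaddleSystem F L b h xs ys lam ell mu H)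
    (ha₀ : 0 < a₀) (hα₀ : 0 < α₀) (hs₀ : 0 < s₀) (hβ₀ : 0 < β₀) (hκ : 0 < κ) :
    ∃ C, 0 ≤ C ∧ ∀ n,
      (∀ᵐ ω ∂P, primalGap h x y (n + 1) ω ≤
        (1 - lam * a₀ * fastScale n) * primalGap h x y n ω + primalMart F h a₀ α₀ N x y n ω
        + C * fastScale n ^ 2 * (1 + primalGap h x y n ω + dualGap ys y n ω)) ∧
      (∀ᵐ ω ∂P, dualGap ys y (n + 1) ω ≤
        (1 - mu * s₀ * slowScale n) * dualGap ys y n ω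
        + ‖L‖ ^ 2 / mu * s₀ * slowScale n * primalGap h x y n ω + dualMart ys β₀ N' y n ω
        + C * slowScale n ^ 2 * (1 + primalGap h x y n ω + dualGap ys y n ω)) := by
  obtain ⟨C₁, hC₁, h1⟩ := hS.primal_step ha₀ hα₀ hs₀ hβ₀ hκ
  obtain ⟨C₂, hC₂, h2⟩ := hS.dual_step hs₀ hβ₀ hκ
  refine ⟨max C₁ C₂, le_max_of_le_left hC₁, fun n => ⟨?_, ?_⟩⟩
  · filter_upwards [hI.growth n] with ω hω
    have g1 := h1 (fastScale n) (slowScale n) (x n ω) (N n ω) (y n ω) (N' n ω)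
      (slowScale_pos n) (slowScale_le_fastScale n) (fastScale_le_one n)
      (fastScale_cube n).symm hω
    unfold primalGap dualGap primalMart
    rw [hI.primal, hI.dual]
    refine g1.trans (add_le_add_right ?_ _)
    gcongr
    exact le_max_left _ _
  · filter_upwards [hI.growth n] with ω hω
    have g1 := h2 (slowScale n) (x n ω) (y n ω) (N' n ω) (slowScale_pos n)
      (by linarith [norm_nonneg (N n ω)])
    unfold primalGap dualGap dualMart
    rw [hI.dual]
    refine g1.trans (add_le_add_right ?_ _)
    gcongr
    exact le_max_right _ _

/-- Almost sure convergence for square-integrable initial values. -/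
theorem ae_tendsto_of_memLp [IsFiniteMeasure P]
    (hI : IsSaddleIteration F L b a₀ α₀ s₀ β₀ κ P ℱ N N' x y)
    (hS : IsSaddleSystem F L b h xs ys lam ell mu H)
    (ha₀ : 0 < a₀) (hα₀ : 0 < α₀) (hs₀ : 0 < s₀) (hβ₀ : 0 < β₀) (hκ : 0 < κ)
    (hx0 : MemLp (x 0) 2 P) (hy0 : MemLp (y 0) 2 P) :
    ∀ᵐ ω ∂P, Tendsto (fun n => (x n ω, y n ω)) atTop (𝓝 (xs, ys)) := by
  obtain ⟨C, hC, hrec⟩ := hI.exists_gap_recursion hS ha₀ hα₀ hs₀ hβ₀ hκ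
  have hlam := hS.lam_pos
  have hmu := hS.mu_pos
  set B := ‖L‖ ^ 2 / mu with hB
  have hB0 : 0 ≤ B := by positivity
  -- From `n₀` on, the primal contraction covers the `B` term of the dual recursion and still leaves
  -- the drift mu·s₀·σ·Z.
  obtain ⟨n₀, hn₀⟩ := eventually_atTop.1
    (eventually_slowScale_le (ε := lam * a₀ / (s₀ * (B + mu))) (by positivity))
  set Z := primalGap h x y with hZ
  set Y := dualGap ys y with hY
  have hZ0 : ∀ n ω, 0 ≤ Z n ω := primalGap_nonneg h x y
  have hY0 : ∀ n ω, 0 ≤ Y n ω := dualGap_nonneg ys y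
  have hint := hI.integrable_gaps hS hx0 hy0
  obtain ⟨hZm, hYm⟩ := hI.adapted_gaps hS
  have hm1 := hI.primalMart_spec hS hx0 hy0
  have hm2 := hI.dualMart_spec hS hx0 hy0
  let ℱ' : Filtration ℕ m0 :=
    ⟨fun n => ℱ (n + n₀), fun i j hij => ℱ.mono (by omega), fun n => ℱ.le _⟩
  have hRS := ae_tendsto_and_summable_of_almost_supermartingale (P := P) (ℱ := ℱ')
    -- The summand 1 turns the additive error into a multiplicative one; both recursions contribute
    -- it, hence the factor 2 in `η`.
    (V := fun n ω => 1 + Z (n + n₀) ω + Y (n + n₀) ω)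
    (D := fun n ω => mu * s₀ * slowScale (n + n₀) * (Z (n + n₀) ω + Y (n + n₀) ω))
    (m := fun n ω => primalMart F h a₀ α₀ N x y (n + n₀) ω + dualMart ys β₀ N' y (n + n₀) ω)
    (η := fun n => 2 * C * fastScale (n + n₀) ^ 2)
    (fun n => by positivity) (((summable_nat_add_iff n₀).2 summable_fastScale_sq).mul_left _)
    (fun n => ((stronglyMeasurable_const (b := (1 : ℝ))).add (hZm (n + n₀))).add (hYm (n + n₀)))
    (fun n => ((hZm (n + n₀)).add (hYm (n + n₀))).const_mul _)
    (fun n => ((integrable_const (1 : ℝ)).add (hint _).1).add (hint _).2)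
    (fun n => ((hint _).1.add (hint _).2).const_mul _)
    (fun n => (hm1 _).1.add (hm2 _).1)
    (fun n ω => by linarith [hZ0 (n + n₀) ω, hY0 (n + n₀) ω])
    (fun n ω => mul_nonneg (by have := slowScale_pos (n + n₀); positivity)
      (add_nonneg (hZ0 _ _) (hY0 _ _)))
    (fun n => by
      refine (condExp_add (hm1 _).1 (hm2 _).1 (ℱ (n + n₀))).trans ?_
      filter_upwards [(hm1 (n + n₀)).2, (hm2 (n + n₀)).2] with ω g1 g2
      rw [Pi.add_apply, g1, g2]
      simp)
    (fun n => by
      filter_upwards [(hrec (n + n₀)).1, (hrec (n + n₀)).2] with ω g1 g2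
      rw [show n + 1 + n₀ = n + n₀ + 1 by omega]
      have g3 := hn₀ (n + n₀) (by omega)
      rw [div_mul_eq_mul_div, le_div_iff₀ (by positivity)] at g3
      have g4 := mul_le_mul_of_nonneg_right g3 (hZ0 (n + n₀) ω)
      have g5 : slowScale (n + n₀) ^ 2 ≤ fastScale (n + n₀) ^ 2 :=
        pow_le_pow_left₀ (slowScale_pos _).le (slowScale_le_fastScale _) 2
      have g6 : 0 ≤ C * (1 + Z (n + n₀) ω + Y (n + n₀) ω) :=
        mul_nonneg hC (by linarith [hZ0 (n + n₀) ω, hY0 (n + n₀) ω])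
      have g7 := mul_le_mul_of_nonneg_right g5 g6
      linarith)
  filter_upwards [hRS] with ω ⟨⟨l, hl⟩, hs⟩
  have hl' : Tendsto (fun n => Z (n + n₀) ω + Y (n + n₀) ω) atTop (𝓝 (l - 1)) := by
    refine (hl.sub_const 1).congr fun n => ?_
    ring
  have hl0 : l - 1 = 0 := by
    refine tendsto_zero_of_summable_mul (d := fun n => mu * s₀ * slowScale (n + n₀))
      (fun n => by have := slowScale_pos (n + n₀); positivity) (fun hsum => ?_)
      (fun n => add_nonneg (hZ0 _ _) (hY0 _ _)) hl' hs
    refine not_summable_slowScale ((summable_nat_add_iff n₀).1 ?_)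
    exact (summable_mul_left_iff (by positivity)).1 hsum
  rw [hl0] at hl'
  have hZY : Tendsto (fun n => Z n ω + Y n ω) atTop (𝓝 0) :=
    (tendsto_add_atTop_iff_nat (f := fun n => Z n ω + Y n ω) n₀).1 hl'
  have hZl : Tendsto (fun n => ‖x n ω - h (y n ω)‖) atTop (𝓝 0) := by
    have := (squeeze_zero (hZ0 · ω) (fun n => by linarith [hY0 n ω]) hZY).sqrt
    simpa [hZ, primalGap, Real.sqrt_sq] using this
  have hYl : Tendsto (fun n => ‖y n ω - ys‖) atTop (𝓝 0) := by
    have := (squeeze_zero (hY0 · ω) (fun n => by linarith [hZ0 n ω]) hZY).sqrt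
    simpa [hY, dualGap, Real.sqrt_sq] using this
  refine Tendsto.prodMk_nhds ?_ (tendsto_iff_norm_sub_tendsto_zero.2 hYl)
  refine tendsto_iff_norm_sub_tendsto_zero.2 (squeeze_zero (fun n => norm_nonneg _)
    (fun n => hS.norm_sub_xs_le (x n ω) (y n ω)) ?_)
  simpa using hZl.add (hYl.const_mul H)

end IsSaddleIteration

end Stochastic

/-! ### Localization of the initial values, and the mean-square rate. -/

namespace IsSaddleIteration

variable {E G Ω : Type*} [NormedAddCommGroup E] [InnerProductSpace ℝ E] [CompleteSpace E]
  [NormedAddCommGroup G] [InnerProductSpace ℝ G] [CompleteSpace G]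
  {m0 : MeasurableSpace Ω} {P : Measure Ω}
  {F : E → E} {L : E →L[ℝ] G} {b : G} {h : G → E} {xs : E} {ys : G} {lam ell mu H : ℝ}
  {a₀ α₀ s₀ β₀ κ : ℝ} {ℱ : Filtration ℕ m0} {N : ℕ → Ω → E} {N' : ℕ → Ω → G}
  {x : ℕ → Ω → E} {y : ℕ → Ω → G}

/-- Freezing the iteration at the equilibrium off an `ℱ 0`-measurable event. -/
lemma localize (hI : IsSaddleIteration F L b a₀ α₀ s₀ β₀ κ P ℱ N N' x y)
    (hS : IsSaddleSystem F L b h xs ys lam ell mu H) (hκ : 0 < κ) {S : Set Ω}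
    (hSm : MeasurableSet[ℱ 0] S) :
    IsSaddleIteration F L b a₀ α₀ s₀ β₀ κ P ℱ
      (fun n => S.indicator (N n)) (fun n => S.indicator (N' n))
      (fun n ω => xs + S.indicator (fun ω => x n ω - xs) ω)
      (fun n ω => ys + S.indicator (fun ω => y n ω - ys) ω) where
  init := stronglyMeasurable_const.add ((hI.init.sub stronglyMeasurable_const).indicator hSm)
  init' := stronglyMeasurable_const.add ((hI.init'.sub stronglyMeasurable_const).indicator hSm)
  noise n := (hI.noise n).indicator (ℱ.mono (Nat.zero_le _) _ hSm)
  noise' n := (hI.noise' n).indicator (ℱ.mono (Nat.zero_le _) _ hSm)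
  integrable n := (hI.integrable n).indicator (ℱ.le 0 _ hSm)
  integrable' n := (hI.integrable' n).indicator (ℱ.le 0 _ hSm)
  condExp n := by
    refine (condExp_indicator (hI.integrable n) (ℱ.mono (Nat.zero_le n) _ hSm)).trans ?_
    filter_upwards [hI.condExp n] with ω hω
    simp [hω]
  condExp' n := by
    refine (condExp_indicator (hI.integrable' n) (ℱ.mono (Nat.zero_le n) _ hSm)).trans ?_
    filter_upwards [hI.condExp' n] with ω hω
    simp [hω]
  growth n := by
    filter_upwards [hI.growth n] with ω hω
    by_cases hωS : ω ∈ S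
    · simpa [hωS] using hω
    · simp only [hωS, not_false_eq_true, Set.indicator_of_notMem, norm_zero, add_zero]
      positivity
  primal n ω := by
    by_cases hωS : ω ∈ S
    · simpa [hωS] using hI.primal n ω
    -- Off the event the noise vanishes, and the equilibrium equation makes the step stationary.
    · simp [hωS, hS.F_xs]
  dual n ω := by
    by_cases hωS : ω ∈ S
    · simpa [hωS] using hI.dual n ω
    · simp [hωS, hS.L_xs]

/-- Almost sure convergence for arbitrary initial values. -/
theorem ae_tendsto [IsFiniteMeasure P]
    (hI : IsSaddleIteration F L b a₀ α₀ s₀ β₀ κ P ℱ N N' x y)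
    (hS : IsSaddleSystem F L b h xs ys lam ell mu H)
    (ha₀ : 0 < a₀) (hα₀ : 0 < α₀) (hs₀ : 0 < s₀) (hβ₀ : 0 < β₀) (hκ : 0 < κ) :
    ∀ᵐ ω ∂P, Tendsto (fun n => (x n ω, y n ω)) atTop (𝓝 (xs, ys)) := by
  -- These countably many events exhaust Ω, and on each of them the localized iteration agrees with
  -- the original one.
  let S : ℕ → Set Ω := fun R => {ω | ‖x 0 ω - xs‖ ≤ R} ∩ {ω | ‖y 0 ω - ys‖ ≤ R}
  have hSm : ∀ R, MeasurableSet[ℱ 0] (S R) := fun R =>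
    ((hI.init.sub stronglyMeasurable_const).norm.measurableSet_le stronglyMeasurable_const).inter
      ((hI.init'.sub stronglyMeasurable_const).norm.measurableSet_le stronglyMeasurable_const)
  have hR : ∀ R : ℕ, ∀ᵐ ω ∂P, ω ∈ S R →
      Tendsto (fun n => (x n ω, y n ω)) atTop (𝓝 (xs, ys)) := by
    intro R
    have hI' := hI.localize hS hκ (hSm R)
    have hm := ℱ.le 0
    have hx0 : MemLp (fun ω => xs + (S R).indicator (fun ω => x 0 ω - xs) ω) 2 P := by
      refine MemLp.of_bound (hI'.init.mono hm).aestronglyMeasurable (‖xs‖ + R)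
        (Eventually.of_forall fun ω => (norm_add_le _ _).trans (add_le_add_right ?_ _))
      by_cases hω : ω ∈ S R
      · simpa [hω] using hω.1
      · simp [hω]
    have hy0 : MemLp (fun ω => ys + (S R).indicator (fun ω => y 0 ω - ys) ω) 2 P := by
      refine MemLp.of_bound (hI'.init'.mono hm).aestronglyMeasurable (‖ys‖ + R)
        (Eventually.of_forall fun ω => (norm_add_le _ _).trans (add_le_add_right ?_ _))
      by_cases hω : ω ∈ S R
      · simpa [hω] using hω.2
      · simp [hω]
    filter_upwards [hI'.ae_tendsto_of_memLp hS ha₀ hα₀ hs₀ hβ₀ hκ hx0 hy0] with ω hω hωS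
    simpa [hωS] using hω
  filter_upwards [ae_all_iff.2 hR] with ω hω
  obtain ⟨R, hRω⟩ := exists_nat_ge (max ‖x 0 ω - xs‖ ‖y 0 ω - ys‖)
  exact hω R ⟨(le_max_left _ _).trans hRω, (le_max_right _ _).trans hRω⟩

/-- The coupled recursions of the expected gaps. -/
lemma exists_expected_gap_recursion [IsProbabilityMeasure P]
    (hI : IsSaddleIteration F L b a₀ α₀ s₀ β₀ κ P ℱ N N' x y)
    (hS : IsSaddleSystem F L b h xs ys lam ell mu H)
    (ha₀ : 0 < a₀) (hα₀ : 0 < α₀) (hs₀ : 0 < s₀) (hβ₀ : 0 < β₀) (hκ : 0 < κ)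
    (hx0 : MemLp (x 0) 2 P) (hy0 : MemLp (y 0) 2 P) :
    ∃ C, 0 ≤ C ∧ ∀ n,
      (∫ ω, primalGap h x y (n + 1) ω ∂P ≤
        (1 - lam * a₀ * fastScale n) * ∫ ω, primalGap h x y n ω ∂P
        + C * fastScale n ^ 2 *
          (1 + ∫ ω, primalGap h x y n ω ∂P + ∫ ω, dualGap ys y n ω ∂P)) ∧
      (∫ ω, dualGap ys y (n + 1) ω ∂P ≤
        (1 - mu * s₀ * slowScale n) * ∫ ω, dualGap ys y n ω ∂P
        + ‖L‖ ^ 2 / mu * s₀ * slowScale n * ∫ ω, primalGap h x y n ω ∂P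
        + C * slowScale n ^ 2 *
          (1 + ∫ ω, primalGap h x y n ω ∂P + ∫ ω, dualGap ys y n ω ∂P)) := by
  obtain ⟨C, hC, hrec⟩ := hI.exists_gap_recursion hS ha₀ hα₀ hs₀ hβ₀ hκ
  have hint := hI.integrable_gaps hS hx0 hy0
  have hzero : ∀ (n : ℕ) {f : Ω → ℝ}, P[f | ℱ n] =ᵐ[P] 0 → ∫ ω, f ω ∂P = 0 := by
    intro n f hf
    rw [← integral_condExp (ℱ.le n), integral_congr_ae hf]
    simp
  refine ⟨C, hC, fun n => ⟨?_, ?_⟩⟩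
  · obtain ⟨i1, i2⟩ := hint n
    obtain ⟨j1, j2⟩ := hI.primalMart_spec hS hx0 hy0 n
    have k1 := ((integrable_const (1 : ℝ)).add i1).add i2
    have k2 := (i1.const_mul (1 - lam * a₀ * fastScale n)).add j1
    have hmono := integral_mono_ae (hint (n + 1)).1
      (k2.add (k1.const_mul (C * fastScale n ^ 2))) (hrec n).1
    rw [integral_add' k2 (k1.const_mul _), integral_add' (i1.const_mul _) j1, hzero n j2,
      integral_const_mul, integral_const_mul,
      integral_add' ((integrable_const (1 : ℝ)).add i1) i2,
      integral_add' (integrable_const (1 : ℝ)) i1, integral_const, probReal_univ, one_smul,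
      add_zero] at hmono
    exact hmono
  · obtain ⟨i1, i2⟩ := hint n
    obtain ⟨j1, j2⟩ := hI.dualMart_spec hS hx0 hy0 n
    have k1 := ((integrable_const (1 : ℝ)).add i1).add i2
    have k3 := (i2.const_mul (1 - mu * s₀ * slowScale n)).add
      (i1.const_mul (‖L‖ ^ 2 / mu * s₀ * slowScale n))
    have k2 := k3.add j1
    have hmono := integral_mono_ae (hint (n + 1)).2
      (k2.add (k1.const_mul (C * slowScale n ^ 2))) (hrec n).2
    rw [integral_add' k2 (k1.const_mul _), integral_add' k3 j1, hzero n j2,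
      integral_add' (i2.const_mul _) (i1.const_mul _),
      integral_const_mul, integral_const_mul, integral_const_mul,
      integral_add' ((integrable_const (1 : ℝ)).add i1) i2,
      integral_add' (integrable_const (1 : ℝ)) i1, integral_const, probReal_univ, one_smul,
      add_zero] at hmono
    exact hmono

/-- Both expected gaps are of the order of the fast scale. -/
lemma exists_expected_gap_rate [IsProbabilityMeasure P]
    (hI : IsSaddleIteration F L b a₀ α₀ s₀ β₀ κ P ℱ N N' x y)
    (hS : IsSaddleSystem F L b h xs ys lam ell mu H)
    (ha₀ : 0 < a₀) (hα₀ : 0 < α₀) (hs₀ : 0 < s₀) (hβ₀ : 0 < β₀) (hκ : 0 < κ)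
    (hmus : 2 ≤ mu * s₀) (hx0 : MemLp (x 0) 2 P) (hy0 : MemLp (y 0) 2 P) :
    ∃ D, 0 ≤ D ∧ ∀ᶠ n in atTop, ∫ ω, primalGap h x y n ω ∂P ≤ D * fastScale n ∧
      ∫ ω, dualGap ys y n ω ∂P ≤ D * fastScale n := by
  obtain ⟨C, hC, hrec⟩ := hI.exists_expected_gap_recursion hS ha₀ hα₀ hs₀ hβ₀ hκ hx0 hy0
  have hlam := hS.lam_pos
  have hmu := hS.mu_pos
  set B := ‖L‖ ^ 2 / mu * s₀ with hB
  have hB0 : 0 ≤ B := by positivity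
  set g := lam * a₀ with hg
  have hg0 : 0 < g := mul_pos hlam ha₀
  set m := mu * s₀ with hm
  set Z : ℕ → ℝ := fun n => ∫ ω, primalGap h x y n ω ∂P
  set Y : ℕ → ℝ := fun n => ∫ ω, dualGap ys y n ω ∂P
  have hZ0 : ∀ n, 0 ≤ Z n := fun n => integral_nonneg (primalGap_nonneg h x y n)
  have hY0 : ∀ n, 0 ≤ Y n := fun n => integral_nonneg (dualGap_nonneg ys y n)
  have hZr : ∀ n, Z (n + 1) ≤ (1 - g * fastScale n) * Z n
      + C * fastScale n ^ 2 * (1 + Z n + Y n) := fun n => (hrec n).1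
  have hYr : ∀ n, Y (n + 1) ≤ (1 - m * slowScale n) * Y n + B * slowScale n * Z n
      + C * slowScale n ^ 2 * (1 + Z n + Y n) := fun n => (hrec n).2
  -- In `B + 2`, the `B` absorbs the primal term of the dual recursion and the 2 lets the primal
  -- contraction track the decay of the fast scale. The second bound keeps both contraction factors
  -- nonnegative.
  obtain ⟨n₀, hn₀⟩ : ∃ n₀, ∀ n ≥ n₀, slowScale n ≤ g / (B + 2) * fastScale n ∧
      fastScale n ≤ 1 / (g + m) := by
    exact eventually_atTop.1 ((eventually_slowScale_le (by positivity)).and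
      (tendsto_fastScale.eventually_le_const (by positivity)))
  have hsg : ∀ n ≥ n₀, (B + 2) * slowScale n ≤ g * fastScale n := by
    intro n hn
    have h1 := (hn₀ n hn).1
    rw [div_mul_eq_mul_div, le_div_iff₀ (by positivity)] at h1
    linarith
  have hfg : ∀ n ≥ n₀, g * fastScale n ≤ 1 ∧ m * slowScale n ≤ 1 := by
    intro n hn
    have h1 := (hn₀ n hn).2
    rw [le_div_iff₀ (by positivity)] at h1
    have h2 := mul_le_mul_of_nonneg_left (slowScale_le_fastScale n) (by linarith : 0 ≤ m)
    have h3 := mul_pos hg0 (fastScale_pos n)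
    have h4 := mul_nonneg (by linarith : 0 ≤ m) (fastScale_pos n).le
    constructor <;> linarith
  -- This a priori bound decouples the recursions: the factor 1 + Z + Y becomes a constant in what
  -- follows.
  obtain ⟨Bd, hBd⟩ := exists_bound_of_recursion (v := fun n => 1 + Z n + Y n)
    (η := fun n => 2 * C * fastScale n ^ 2) (n₀ := n₀) (fun n => by positivity)
    (summable_fastScale_sq.mul_left _) (fun n => by linarith [hZ0 n, hY0 n]) (fun n hn => by
      have h1 : slowScale n ^ 2 ≤ fastScale n ^ 2 :=
        pow_le_pow_left₀ (slowScale_pos n).le (slowScale_le_fastScale n) 2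
      have h2 := mul_le_mul_of_nonneg_right h1
        (mul_nonneg hC (by linarith [hZ0 n, hY0 n] : 0 ≤ 1 + Z n + Y n))
      have h3 := mul_le_mul_of_nonneg_right (hsg n hn) (hZ0 n)
      have h4 := mul_nonneg (slowScale_pos n).le (hZ0 n)
      have h5 := mul_nonneg (mul_nonneg (by linarith : 0 ≤ m) (slowScale_pos n).le) (hY0 n)
      linarith [hZr n, hYr n])
  have hBd0 : 0 ≤ Bd := by linarith [hBd n₀ le_rfl, hZ0 n₀, hY0 n₀]
  obtain ⟨D₁, hD₁, hZD⟩ := exists_rate_of_recursion (z := Z) (g := fun n => g * fastScale n)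
    (ρ := fastScale) (C := C * Bd / g) (n₀ := n₀) (by positivity) fastScale_pos
    (fun n _ => (mul_pos hg0 (fastScale_pos n)).le) (fun n hn => (hfg n hn).1)
    (fun n hn => by
      have h1 := mul_le_mul_of_nonneg_right (hsg n hn) (fastScale_pos n).le
      have h2 := mul_nonneg (mul_nonneg hB0 (slowScale_pos n).le) (fastScale_pos n).le
      linarith [fastScale_sub_succ_le n])
    (fun n hn => by
      have h1 := mul_le_mul_of_nonneg_left (hBd n hn)
        (mul_nonneg hC (sq_nonneg (fastScale n)))
      have h2 : C * Bd / g * (g * fastScale n * fastScale n) = C * fastScale n ^ 2 * Bd := by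
        field_simp
      linarith [hZr n])
  have hm0 : 0 < m := by linarith
  -- The contraction mσ must be at least twice the relative decay σ of the fast scale; this is where
  -- `2 ≤ mu * s₀` is needed. The primal rate bounds the forcing by const·σ·r.
  obtain ⟨D₂, hD₂, hYD⟩ := exists_rate_of_recursion (z := Y) (g := fun n => m * slowScale n)
    (ρ := fastScale) (C := (B * D₁ + C * Bd) / m) (n₀ := n₀) (by positivity) fastScale_pos
    (fun n _ => (mul_pos hm0 (slowScale_pos n)).le) (fun n hn => (hfg n hn).2)
    (fun n hn => by
      have h1 := mul_le_mul_of_nonneg_right hmus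
        (mul_pos (slowScale_pos n) (fastScale_pos n)).le
      linarith [fastScale_sub_succ_le n])
    (fun n hn => by
      have h1 := mul_le_mul_of_nonneg_left (hBd n hn)
        (mul_nonneg hC (sq_nonneg (slowScale n)))
      have h2 := mul_le_mul_of_nonneg_left (hZD n hn) (mul_nonneg hB0 (slowScale_pos n).le)
      have h3 : (B * D₁ + C * Bd) / m * (m * slowScale n * fastScale n) =
          (B * D₁ + C * Bd) * (slowScale n * fastScale n) := by
        field_simp
      have h4 := mul_le_mul_of_nonneg_left (slowScale_le_fastScale n)
        (mul_nonneg (mul_nonneg hC hBd0) (slowScale_pos n).le)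
      linarith [hYr n])
  refine ⟨max D₁ D₂, le_max_of_le_left hD₁, eventually_atTop.2 ⟨n₀, fun n hn => ?_⟩⟩
  exact ⟨(hZD n hn).trans (mul_le_mul_of_nonneg_right (le_max_left _ _) (fastScale_pos n).le),
    (hYD n hn).trans (mul_le_mul_of_nonneg_right (le_max_right _ _) (fastScale_pos n).le)⟩

/-- The mean square error is finite and of the order of the fast scale. -/
theorem integrable_and_isBigO [IsProbabilityMeasure P]
    (hI : IsSaddleIteration F L b a₀ α₀ s₀ β₀ κ P ℱ N N' x y)
    (hS : IsSaddleSystem F L b h xs ys lam ell mu H)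
    (ha₀ : 0 < a₀) (hα₀ : 0 < α₀) (hs₀ : 0 < s₀) (hβ₀ : 0 < β₀) (hκ : 0 < κ)
    (hmus : 2 ≤ mu * s₀) (hx0 : MemLp (x 0) 2 P) (hy0 : MemLp (y 0) 2 P) :
    (∀ n, Integrable (fun ω => ‖L (x n ω) - b‖ ^ 2 + ‖x n ω - xs‖ ^ 2) P) ∧
      (fun n => ∫ ω, (‖L (x n ω) - b‖ ^ 2 + ‖x n ω - xs‖ ^ 2) ∂P) =O[atTop] fastScale := by
  have hint : ∀ n, Integrable (fun ω => ‖L (x n ω) - b‖ ^ 2 + ‖x n ω - xs‖ ^ 2) P := by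
    intro n
    have hx := (hI.memLp hS hx0 hy0 n).1
    exact (((L.comp_memLp' hx).sub (memLp_const b)).integrable_norm_pow two_ne_zero).add
      ((hx.sub (memLp_const xs)).integrable_norm_pow two_ne_zero)
  refine ⟨hint, ?_⟩
  obtain ⟨D, hD, hrate⟩ := hI.exists_expected_gap_rate hS ha₀ hα₀ hs₀ hβ₀ hκ hmus hx0 hy0
  have hgaps := hI.integrable_gaps hS hx0 hy0
  refine IsBigO.of_bound ((‖L‖ ^ 2 + 1) * (2 * D + 2 * H ^ 2 * D)) ?_
  filter_upwards [hrate] with n ⟨h1, h2⟩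
  have h0 : 0 ≤ ∫ ω, (‖L (x n ω) - b‖ ^ 2 + ‖x n ω - xs‖ ^ 2) ∂P :=
    integral_nonneg fun ω => add_nonneg (sq_nonneg _) (sq_nonneg _)
  rw [Real.norm_of_nonneg h0,
    Real.norm_of_nonneg (fastScale_pos n).le]
  have hle : ∀ ω, ‖L (x n ω) - b‖ ^ 2 + ‖x n ω - xs‖ ^ 2 ≤
      (‖L‖ ^ 2 + 1) * (2 * primalGap h x y n ω + 2 * H ^ 2 * dualGap ys y n ω) := by
    intro ω
    have g1 := pow_le_pow_left₀ (norm_nonneg _) (hS.norm_L_sub_le (x n ω)) 2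
    have g2 := pow_le_pow_left₀ (norm_nonneg _) (hS.norm_sub_xs_le (x n ω) (y n ω)) 2
    have g3 : (‖x n ω - h (y n ω)‖ + H * ‖y n ω - ys‖) ^ 2 ≤
        2 * primalGap h x y n ω + 2 * H ^ 2 * dualGap ys y n ω := by
      unfold primalGap dualGap
      nlinarith [sq_nonneg (‖x n ω - h (y n ω)‖ - H * ‖y n ω - ys‖)]
    have g4 := mul_le_mul_of_nonneg_left (g2.trans g3)
      (by positivity : 0 ≤ ‖L‖ ^ 2 + 1)
    linarith
  have k1 := (hgaps n).1.const_mul 2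
  have k2 := (hgaps n).2.const_mul (2 * H ^ 2)
  have hmono := integral_mono (hint n) ((k1.add k2).const_mul (‖L‖ ^ 2 + 1)) hle
  rw [integral_const_mul, integral_add' k1 k2, integral_const_mul, integral_const_mul] at hmono
  have h3 := add_le_add (mul_le_mul_of_nonneg_left h1 zero_le_two)
    (mul_le_mul_of_nonneg_left h2 (by positivity : 0 ≤ 2 * H ^ 2))
  have h4 := mul_le_mul_of_nonneg_left h3 (by positivity : 0 ≤ ‖L‖ ^ 2 + 1)
  linarith

end IsSaddleIteration

/-! ### The game -/

/-- The continuous linear map of a matrix between Euclidean spaces. -/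
def matCLM {m n : Type*} [Fintype m] [Fintype n] (A : Matrix m n ℝ) :
    EuclideanSpace ℝ n →L[ℝ] EuclideanSpace ℝ m :=
  LinearMap.toContinuousLinearMap
    { toFun := matVec A
      map_add' := fun v w => by ext i; simp [matVec, Matrix.mulVec_add]
      map_smul' := fun c v => by ext i; simp [matVec, Matrix.mulVec_smul] }

lemma matCLM_apply {m n : Type*} [Fintype m] [Fintype n] (A : Matrix m n ℝ)
    (v : EuclideanSpace ℝ n) : matCLM A v = matVec A v := rfl

lemma adjoint_matCLM {m n : Type*} [Fintype m] [Fintype n] (A : Matrix m n ℝ) :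
    (matCLM A).adjoint = matCLM Aᵀ := by
  refine ((ContinuousLinearMap.eq_adjoint_iff _ _).2 fun y x => ?_).symm
  rw [matCLM_apply, matCLM_apply, EuclideanSpace.inner_eq_star_dotProduct,
    EuclideanSpace.inner_eq_star_dotProduct]
  simp only [matVec, star_trivial]
  rw [Matrix.mulVec_transpose, dotProduct_comm, ← Matrix.dotProduct_mulVec, dotProduct_comm]

/-- A matrix of full row rank has a transpose that is bounded below. -/
lemma exists_norm_le_adjoint_matCLM {n : Type*} [Fintype n] {c : ℕ} (A : Matrix (Fin c) n ℝ)
    (hA : A.rank = c) : ∃ κ : ℝ, 0 < κ ∧ ∀ y, κ * ‖y‖ ≤ ‖(matCLM A).adjoint y‖ := by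
  have hinj : Function.Injective (Aᵀ.mulVec) := by
    rw [Matrix.mulVec_injective_iff, linearIndependent_iff_card_eq_finrank_span]
    rw [Matrix.rank_eq_finrank_span_row] at hA
    exact (Fintype.card_fin c).trans hA.symm
  have hker : LinearMap.ker (matCLM Aᵀ : EuclideanSpace ℝ (Fin c) →ₗ[ℝ] EuclideanSpace ℝ n) = ⊥ := by
    rw [LinearMap.ker_eq_bot]
    intro y y' hyy
    exact WithLp.ofLp_injective 2 (hinj (congrArg WithLp.ofLp hyy))
  obtain ⟨K, hK0, hK⟩ := LinearMap.exists_antilipschitzWith _ hker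
  refine ⟨(K : ℝ)⁻¹, by positivity, fun y => ?_⟩
  rw [adjoint_matCLM, inv_mul_le_iff₀ (by positivity)]
  simpa using hK.le_mul_dist y 0

/-- The filtration of the histories. -/
def historyFiltration {Ω E G : Type*} [mΩ : MeasurableSpace Ω] [MeasurableSpace E]
    [MeasurableSpace G] {x₀ : Ω → E} {y₀ : Ω → G} (N : ℕ → Ω → E) (N' : ℕ → Ω → G)
    (hx₀ : Measurable x₀) (hy₀ : Measurable y₀)
    (hN : ∀ n, Measurable (N (n + 1)) ∧ Measurable (N' (n + 1))) : Filtration ℕ mΩ where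
  seq := history x₀ y₀ N N'
  mono' := fun _ _ hij => sup_le_sup_left
    (biSup_mono fun _ hk => ⟨hk.1, hk.2.trans hij⟩) _
  le' := fun n => by
    refine sup_le (sup_le hx₀.comap_le hy₀.comap_le) (iSup₂_le fun k hk => ?_)
    -- Measurability of the noise is assumed for positive indices only; index 0 does not enter the
    -- histories.
    obtain ⟨j, rfl⟩ : ∃ j, k = j + 1 := ⟨k - 1, by have := hk.1; omega⟩
    exact sup_le (hN j).1.comap_le (hN j).2.comap_le

lemma measurable_history_init {Ω E G : Type*} [MeasurableSpace E] [MeasurableSpace G]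
    (x₀ : Ω → E) (y₀ : Ω → G) (N : ℕ → Ω → E) (N' : ℕ → Ω → G) (n : ℕ) :
    Measurable[history x₀ y₀ N N' n] x₀ ∧ Measurable[history x₀ y₀ N N' n] y₀ :=
  ⟨measurable_iff_comap_le.2 (le_sup_left.trans le_sup_left),
    measurable_iff_comap_le.2 (le_sup_right.trans le_sup_left)⟩

lemma measurable_history_noise {Ω E G : Type*} [MeasurableSpace E] [MeasurableSpace G]
    (x₀ : Ω → E) (y₀ : Ω → G) (N : ℕ → Ω → E) (N' : ℕ → Ω → G) (n : ℕ) :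
    Measurable[history x₀ y₀ N N' (n + 1)] (N (n + 1)) ∧
      Measurable[history x₀ y₀ N N' (n + 1)] (N' (n + 1)) := by
  have h : MeasurableSpace.comap (N (n + 1)) inferInstance ⊔
      MeasurableSpace.comap (N' (n + 1)) inferInstance ≤ history x₀ y₀ N N' (n + 1) :=
    le_sup_of_le_right (le_iSup₂_of_le (f := fun k (_ : k ∈ Set.Icc 1 (n + 1)) =>
      MeasurableSpace.comap (N k) inferInstance ⊔ MeasurableSpace.comap (N' k) inferInstance)
      (n + 1) ⟨by omega, le_rfl⟩ le_rfl)
  exact ⟨measurable_iff_comap_le.2 (le_sup_left.trans h),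
    measurable_iff_comap_le.2 (le_sup_right.trans h)⟩

/-- The noises here already carry the factors α' and β', so they are multiplied by α₀ and β₀ alone,
while the drifts get α'α₀ and β'β₀. The noise index is shifted by one. -/
lemma IsPrimalDualIteration.isSaddleIteration {Ω : Type*} [mΩ : MeasurableSpace Ω] {P : Measure Ω}
    {K d c : ℕ} {u : Fin K → Joint K d → ℝ} {A : Matrix (Fin c) (Fin K × Fin d) ℝ}
    {b : EuclideanSpace ℝ (Fin c)} {α' β' α₀ β₀ κ : ℝ}
    {M : ℕ → Ω → Joint K d} {M' : ℕ → Ω → EuclideanSpace ℝ (Fin c)}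
    {x : ℕ → Ω → Joint K d} {y : ℕ → Ω → EuclideanSpace ℝ (Fin c)}
    (hit : IsPrimalDualIteration u A b
      (fun n => α' * (α₀ / ((n : ℝ) + 1) ^ (2 / 3 : ℝ)))
      (fun n => β' * (β₀ / ((n : ℝ) + 1))) M M' x y)
    (hn : IsMartingaleNoise P κ x y (fun n ω => α' • M n ω) (fun n ω => β' • M' n ω)) :
    IsSaddleIteration (gradientOperator u) (matCLM A) b (α' * α₀) α₀ (β' * β₀) β₀ κ P
      (historyFiltration (fun n ω => α' • M n ω) (fun n ω => β' • M' n ω)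
        hn.measurable_init.1 hn.measurable_init.2 hn.measurable_noise)
      (fun n ω => α' • M (n + 1) ω) (fun n ω => β' • M' (n + 1) ω) x y where
  init := (measurable_history_init _ _ _ _ 0).1.stronglyMeasurable
  init' := (measurable_history_init _ _ _ _ 0).2.stronglyMeasurable
  noise n := (measurable_history_noise _ _ (fun n ω => α' • M n ω) (fun n ω => β' • M' n ω)
    n).1.stronglyMeasurable
  noise' n := (measurable_history_noise _ _ (fun n ω => α' • M n ω) (fun n ω => β' • M' n ω)
    n).2.stronglyMeasurable
  integrable n := (hn.integrable_noise n).1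
  integrable' n := (hn.integrable_noise n).2
  condExp := hn.condExp_eq_zero
  condExp' := hn.condExp_eq_zero'
  growth := hn.linear_growth
  primal n ω := by
    ext p
    have h1 := congrArg (fun v : EuclideanSpace ℝ (Fin d) => v p.2) (hit.primal n ω p.1)
    simp only [action, PiLp.add_apply, PiLp.smul_apply, PiLp.sub_apply, smul_eq_mul] at h1
    simp only [PiLp.add_apply, PiLp.smul_apply, PiLp.sub_apply, smul_eq_mul, adjoint_matCLM,
      matCLM_apply, gradientOperator, fastScale]
    rw [h1]
    ring
  dual n ω := by
    rw [hit.dual, matCLM_apply]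
    unfold slowScale
    module

end GNELearning

end

open GNELearning in
theorem mainTheorem6 (K d c : ℕ) (A : Matrix (Fin c) (Fin K × Fin d) ℝ) (hA : A.rank = c)
    (lam : ℝ) (hlam : 0 < lam) (ell : ℝ≥0) (β' : ℝ) (hβ' : 0 < β') :
    ∃ C₃ : ℝ, 0 < C₃ ∧
      ∀ u : Fin K → Joint K d → ℝ, IsStronglyMonotoneGame u lam ell →
      ∀ b : EuclideanSpace ℝ (Fin c),
      ∃ (xs : Joint K d) (ys : EuclideanSpace ℝ (Fin c)),
        -- `(xs, ys)` is the unique solution of `A x = b`, `F(x) = Aᵀ y`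
        (∀ (x : Joint K d) (y : EuclideanSpace ℝ (Fin c)),
          (matVec A x = b ∧ gradientOperator u x = matVec Aᵀ y) ↔ (x = xs ∧ y = ys)) ∧
        ∀ (α' α₀ β₀ κ : ℝ), 0 < α' → 0 < α₀ → 0 < β₀ → 0 < κ →
        ∀ (Ω : Type*) [MeasurableSpace Ω] (P : Measure Ω) [IsProbabilityMeasure P]
          (M : ℕ → Ω → Joint K d) (M' : ℕ → Ω → EuclideanSpace ℝ (Fin c))
          (x : ℕ → Ω → Joint K d) (y : ℕ → Ω → EuclideanSpace ℝ (Fin c)),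
          IsPrimalDualIteration u A b
            (fun n => α' * (α₀ / ((n : ℝ) + 1) ^ (2 / 3 : ℝ)))
            (fun n => β' * (β₀ / ((n : ℝ) + 1))) M M' x y →
          IsMartingaleNoise P κ x y (fun n ω => α' • M n ω) (fun n ω => β' • M' n ω) →
          (∀ᵐ ω ∂P, Tendsto (fun n => (x n ω, y n ω)) atTop (𝓝 (xs, ys))) ∧
          (C₃ ≤ β₀ → MemLp (x 0) 2 P → MemLp (y 0) 2 P →
            (∀ n, Integrable (fun ω => ‖matVec A (x n ω) - b‖ ^ 2 + ‖x n ω - xs‖ ^ 2) P) ∧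
            (fun n : ℕ => ∫ ω, (‖matVec A (x n ω) - b‖ ^ 2 + ‖x n ω - xs‖ ^ 2) ∂P)
              =O[atTop] (fun n : ℕ => 1 / ((n : ℝ) + 1) ^ (2 / 3 : ℝ))) := by
  obtain ⟨σ, hσ, hσA⟩ := exists_norm_le_adjoint_matCLM A hA
  -- `ell` may be 0, whereas the dual modulus divides by the Lipschitz constant; ell + 1 is still a
  -- Lipschitz constant.
  have hell : (0 : ℝ) < (ell : ℝ) + 1 := by positivity
  -- This is 2/(mu·β') for the dual modulus `mu`, so `C₃ ≤ β₀` says exactly 2 ≤ mu·β'·β₀; it is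
  -- fixed before the utilities and `b`.
  refine ⟨2 / (lam * σ ^ 2 / ((ell : ℝ) + 1) ^ 2 * β'), by positivity, fun u hu b => ?_⟩
  obtain ⟨h, xs, ys, hS⟩ := exists_isSaddleSystem b hlam hell hσ hσA hu.strongly_monotone
    (fun x x' => by
      have h1 := hu.lipschitz.dist_le_mul x' x
      rw [dist_eq_norm, dist_eq_norm] at h1
      linarith [norm_nonneg (x' - x)])
  refine ⟨xs, ys, fun x y => ?_, ?_⟩
  · rw [← hS.solution_iff x y, adjoint_matCLM, matCLM_apply, matCLM_apply]
  · intro α' α₀ β₀ κ hα' hα₀ hβ₀ hκ Ω _ P _ M M' x y hit hn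
    have hI := hit.isSaddleIteration hn
    refine ⟨hI.ae_tendsto hS (mul_pos hα' hα₀) hα₀ (mul_pos hβ' hβ₀) hβ₀ hκ,
      fun hC hx0 hy0 => ?_⟩
    refine hI.integrable_and_isBigO hS (mul_pos hα' hα₀) hα₀ (mul_pos hβ' hβ₀) hβ₀ hκ ?_ hx0 hy0
    rw [div_le_iff₀ (by have := hS.mu_pos; positivity)] at hC
    linarith
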